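/- Let $d \geq 1$, let $I := [-1,1]$ and let $\gamma : I \to \mathbb{R}^d$ be a $C^\infty$ curve that is non-degenerate, i.e. $\det\big(\gamma^{(1)}(s)\ \cdots\ \gamma^{(d)}(s)\big) \neq 0$ for all $s \in I$. For $0<\delta<1$ and $s \in I$ let \[ T_\delta(s) := \{(y,t) \in \mathbb{R}^d \times I : |y - t\gamma(s)| \leq \delta\}, \] and for $g \in L^1_{\mathrm{loc}}(\mathbb{R}^{d+1})$ (complex valued) and $x \in \mathbb{R}^d$ define \[ \mathcal{A}_\delta^\gamma g(x,s) := \frac{1}{|T_\delta(s)|} \int_{T_\delta(s)} g(x-y,t)\,\mathrm{d}y\,\mathrm{d}t, \qquad \mathcal{N}_\delta^\gamma g(x) := \sup_{s \in I} |\mathcal{A}_\delta^\gamma g(x,s)|. \] Then there is a constant $C_{d,\gamma} > 0$, depending only on $d$ and $\gamma$, such that for all $0 < \delta < 1$ the operator $\mathcal{N}_\delta^\gamma$ maps $L^2(\mathbb{R}^{d+1})$ to $L^2(\mathbb{R}^d)$ with \[ \|\mathcal{N}_\delta^\gamma g\|_{L^2(\mathbb{R}^d)} \leq C_{d,\gamma}\,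 \big(\max\{1, \log \delta^{-1}\}\big)^{d/2}\, \|g\|_{L^2(\mathbb{R}^{d+1})} \qquad \text{for all } g \in L^2(\mathbb{R}^{d+1}). \] -/

import Mathlib

open MeasureTheory Set
open scoped ENNReal ContDiff

noncomputable section

namespace Nikodym

/-- `ℝ^d` with its Euclidean norm and Lebesgue measure. -/
abbrev E (d : ℕ) : Type := EuclideanSpace ℝ (Fin d)

/-- The parameter interval `I = [-1, 1]`. -/
def I : Set ℝ := Icc (-1) 1

/-- `γ : [-1, 1] → ℝ^d` is smooth and the determinant of the matrix with columns
`γ^(1)(s), …, γ^(d)(s)` vanishes at no `s ∈ [-1, 1]` (derivatives are one-sided at the endpoints;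
the values of `γ` off `[-1, 1]` play no role). -/
def IsNondegenerate {d : ℕ} (γ : ℝ → E d) : Prop :=
  ContDiffOn ℝ ∞ γ I ∧
    ∀ s ∈ I, (Matrix.of fun i j : Fin d => iteratedDerivWithin ((j : ℕ) + 1) γ I s i).det ≠ 0

/-- The `δ`-tube `{(y, t) ∈ ℝ^d × I : |y - t γ(s)| ≤ δ}`. -/
def tube {d : ℕ} (γ : ℝ → E d) (δ s : ℝ) : Set (E d × ℝ) :=
  {p | p.2 ∈ I ∧ ‖p.1 - p.2 • γ s‖ ≤ δ}

/-- The average `|T_δ(s)|⁻¹ ∫_{T_δ(s)} g (x - y, t) dy dt`. -/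
def avg {d : ℕ} (γ : ℝ → E d) (δ : ℝ) (g : E d × ℝ → ℂ) (x : E d) (s : ℝ) : ℂ :=
  ⨍ p in tube γ δ s, g (x - p.1, p.2)

/-- The maximal function `sup_{s ∈ I} |avg g (x, s)|`, with values in `[0, ∞]`. -/
def maximal {d : ℕ} (γ : ℝ → E d) (δ : ℝ) (g : E d × ℝ → ℂ) (x : E d) : ℝ≥0∞ :=
  ⨆ s ∈ I, ‖avg γ δ g x s‖ₑ

end Nikodym

end

/-! The supremum over `s` is controlled by an `H^{1/2}` energy in `s`; since the endpoint Sobolev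
embedding fails, this costs a factor `log δ⁻¹`. Cut `[-1, 1]` into `N` intervals `[α, β]` so short
that on each of them every frequency `ξ` is detected by a single derivative of `γ`
(`exists_uniform_nondegenerate`). For a non-negative function the average over the tube at `s` is at
most a constant times the Gaussian average `gaussAvg` at any `r` with `|r - s| ≤ δ`, hence at most a
constant times the mean of the latter over an interval of length `ε = (β - α) / 2 * δ` ending at
`s`. By `exists_enorm_sq_average_le` the square of such a mean is bounded by an `L²` term plus `log
δ⁻¹` times the `gagliardo` energy at scale `ε`. This majorant, `energy`, no longer depends on `s`
and can be integrated in `x`.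

By Plancherel in `x`, the transform of the Gaussian average at `ξ` is a factor at most `1` times `G
(h s)`, where `h s = ⟪γ s, ξ⟫` and `G` is the Fourier transform of a function of `t` supported in
`[-1, 1]`. So `G` and `G'` are in `L²` and `G` is bounded, all by the `L²` norm of `partialFourier g
ξ` (`fourier_band_limited`). It remains to bound the energy of `G ∘ h` uniformly in `ξ`.

If `|h'|` is comparable to `R = |ξ|`, the substitution `u = h s` bounds the mean-square increment at
distance `v` by `min (v² R) R⁻¹`, and the energy is bounded with no logarithm
(`gagliardo_comp_le_of_deriv`). If a derivative of order at least two does not vanish, Rolle's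
theorem bounds how often `h'` takes a given value, the increments are `O(v)`, and the energy is
`O(log δ⁻¹)` up to the maximum with `1` (`gagliardo_comp_le_of_iterated_deriv`). Together with the
Sobolev logarithm the squared norm costs one logarithm in the first case and two in the second. The
second occurs only for `d ≥ 2`, so the `d`-th power suffices in both. General `g` are reached by
truncating `|g|` and applying Fatou's lemma. -/

namespace Nikodym

/-! ### Plancherel's theorem for the Fourier integral on `L¹ ∩ L²`. -/

section Plancherel

open FourierTransform SchwartzMap

variable {V : Type*} [NormedAddCommGroup V] [InnerProductSpace ℝ V] [FiniteDimensional ℝ V]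
  [MeasurableSpace V] [BorelSpace V]

theorem continuous_fourier {f : V → ℂ} (hf : Integrable f) : Continuous (𝓕 f) :=
  VectorFourier.fourierIntegral_continuous Real.continuous_fourierChar
    (innerSL ℝ).continuous₂ hf

/-- On `L¹ ∩ L²` the Fourier integral represents the `L²` Fourier transform. -/
theorem coeFn_fourier_toLp_ae_eq {f : V → ℂ} (hf : Integrable f) (hf2 : MemLp f 2) :
    (𝓕 (hf2.toLp f) : Lp ℂ 2 (volume : Measure V)) =ᵐ[volume] 𝓕 f := by
  refine ae_eq_of_integral_contDiff_smul_eq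
    ((Lp.memLp _).locallyIntegrable (by norm_num)) (continuous_fourier hf).locallyIntegrable ?_
  intro g hg hgc
  have hg₁ : HasCompactSupport (Complex.ofRealCLM ∘ g) := hgc.comp_left rfl
  have hg₂ : ContDiff ℝ ∞ (Complex.ofRealCLM ∘ g) := by fun_prop
  -- The test function is Schwartz, so both transforms can be moved onto it: one by the definition
  -- of the distributional transform, the other by Fubini.
  set ψ : 𝓢(V, ℂ) := hg₁.toSchwartzMap hg₂ with hψ
  have h1 := congrArg (fun T => T ψ)
    (MeasureTheory.Lp.fourier_toTemperedDistribution_eq (hf2.toLp f))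
  simp only [TemperedDistribution.fourier_apply, Lp.toTemperedDistribution_apply] at h1
  have h2 : ∫ ξ, 𝓕 (ψ : V → ℂ) ξ • f ξ = ∫ x, ψ x • 𝓕 f x := by
    simpa using! VectorFourier.integral_fourierIntegral_smul_eq_flip (L := innerₗ V)
      Real.continuous_fourierChar continuous_inner ψ.integrable hf
  have h3 : ∫ x, (𝓕 ψ) x • (hf2.toLp f) x = ∫ ξ, 𝓕 (ψ : V → ℂ) ξ • f ξ := by
    refine integral_congr_ae ?_
    filter_upwards [hf2.coeFn_toLp] with x hx
    rw [hx, SchwartzMap.fourier_coe]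
  have e (u : V → ℂ) : ∫ x, g x • u x = ∫ x, ψ x • u x := by
    simp [hψ]
  rw [e, e, ← h2, ← h3, h1]

theorem lintegral_enorm_sq_eq_eLpNorm {α : Type*} [MeasurableSpace α] {μ : Measure α}
    (f : α → ℂ) : ∫⁻ x, ‖f x‖ₑ ^ 2 ∂μ = eLpNorm f 2 μ ^ 2 := by
  rw [eLpNorm_eq_lintegral_rpow_enorm_toReal (by norm_num) (by norm_num), ← ENNReal.rpow_natCast,
    ← ENNReal.rpow_mul]
  simp

/-- Plancherel's theorem on `L¹ ∩ L²`. -/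
theorem lintegral_enorm_fourier_sq {f : V → ℂ} (hf : Integrable f) (hf2 : MemLp f 2) :
    ∫⁻ ξ, ‖𝓕 f ξ‖ₑ ^ 2 = ∫⁻ x, ‖f x‖ₑ ^ 2 := by
  rw [lintegral_enorm_sq_eq_eLpNorm, lintegral_enorm_sq_eq_eLpNorm,
    ← eLpNorm_congr_ae (coeFn_fourier_toLp_ae_eq hf hf2), ← Lp.enorm_def, ← ofReal_norm,
    Lp.norm_fourier_eq, ofReal_norm, Lp.enorm_toLp]

theorem lintegral_enorm_fourierInv_sq {f : V → ℂ} (hf : Integrable f) (hf2 : MemLp f 2) :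
    ∫⁻ ξ, ‖𝓕⁻ f ξ‖ₑ ^ 2 = ∫⁻ x, ‖f x‖ₑ ^ 2 := by
  simp_rw [Real.fourierInv_eq_fourier_neg]
  rw [lintegral_neg_eq_self (fun ξ => ‖𝓕 f ξ‖ₑ ^ 2), lintegral_enorm_fourier_sq hf hf2]

end Plancherel

end Nikodym

namespace Nikodym

/-! ### Endpoint Sobolev inequality in one variable, with a logarithmic loss. -/

section OneDim

theorem sq_intervalIntegral_mul_le {a b : ℝ} (hab : a ≤ b) {f g : ℝ → ℝ}
    (hf : ContinuousOn f (Icc a b)) (hg : ContinuousOn g (Icc a b)) :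
    (∫ x in a..b, f x * g x) ^ 2 ≤ (∫ x in a..b, f x ^ 2) * ∫ x in a..b, g x ^ 2 := by
  have i1 : IntervalIntegrable (fun x => f x ^ 2) volume a b :=
    (hf.pow 2).intervalIntegrable_of_Icc hab
  have i2 : IntervalIntegrable (fun x => g x ^ 2) volume a b :=
    (hg.pow 2).intervalIntegrable_of_Icc hab
  have i3 : IntervalIntegrable (fun x => f x * g x) volume a b :=
    (hf.mul hg).intervalIntegrable_of_Icc hab
  have key : ∀ τ : ℝ, 0 ≤ (∫ x in a..b, g x ^ 2) * (τ * τ) + (2 * ∫ x in a..b, f x * g x) * τ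
      + ∫ x in a..b, f x ^ 2 := by
    intro τ
    have : (∫ x in a..b, (f x + τ * g x) ^ 2) = (∫ x in a..b, g x ^ 2) * (τ * τ)
        + (2 * ∫ x in a..b, f x * g x) * τ + ∫ x in a..b, f x ^ 2 := by
      rw [← intervalIntegral.integral_const_mul, ← intervalIntegral.integral_mul_const,
        ← intervalIntegral.integral_mul_const, ← intervalIntegral.integral_add,
        ← intervalIntegral.integral_add]
      · exact intervalIntegral.integral_congr fun x _ => by ring
      · exact (i2.mul_const _).add ((i3.const_mul _).mul_const _)
      · exact i1
      · exact i2.mul_const _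
      · exact (i3.const_mul _).mul_const _
    rw [← this]
    exact intervalIntegral.integral_nonneg hab fun x _ => sq_nonneg _
  have := discrim_le_zero key
  rw [discrim] at this
  nlinarith

theorem norm_intervalIntegral_sq_le {a b : ℝ} (hab : a ≤ b) {f : ℝ → ℂ}
    (hf : ContinuousOn f (Icc a b)) :
    ‖∫ x in a..b, f x‖ ^ 2 ≤ (b - a) * ∫ x in a..b, ‖f x‖ ^ 2 := by
  have h1 := sq_intervalIntegral_mul_le hab (f := fun _ => 1) continuousOn_const hf.norm
  have h2 := intervalIntegral.norm_integral_le_integral_norm (f := f) (μ := volume) hab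
  simp only [one_mul, one_pow, intervalIntegral.integral_const, smul_eq_mul, mul_one] at h1
  exact (pow_le_pow_left₀ (norm_nonneg _) h2 2).trans h1

/-- The derivative of the running average `r⁻¹ ∫₀ʳ f`. -/
theorem hasDerivAt_running_average {f : ℝ → ℂ} (hf : Continuous f) {r : ℝ} (hr : 0 < r) :
    HasDerivAt (fun r : ℝ => r⁻¹ • ∫ u in (0 : ℝ)..r, f u)
      ((r ^ 2)⁻¹ • ∫ u in (0 : ℝ)..r, (f r - f u)) r := by
  have h1 : HasDerivAt (fun r : ℝ => ∫ u in (0 : ℝ)..r, f u) (f r) r :=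
    intervalIntegral.integral_hasDerivAt_right (hf.intervalIntegrable _ _)
      (hf.stronglyMeasurableAtFilter _ _) hf.continuousAt
  have h2 := (hasDerivAt_inv hr.ne').smul h1
  convert! h2 using 1
  rw [intervalIntegral.integral_sub intervalIntegrable_const (hf.intervalIntegrable _ _)]
  simp only [intervalIntegral.integral_const, sub_zero, smul_sub, smul_smul, neg_smul]
  rw [show (r ^ 2)⁻¹ * r = r⁻¹ by field_simp]
  abel

/-- Write the mean at scale `ε` as the mean at scale `l` minus the integral of the derivative `M'`
of the running mean. Cauchy–Schwarz with the weight `dr / r` gives the factor `∫ dr / r = log (l /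
ε)` and leaves `∫ r |M'|² dr`, where a second Cauchy–Schwarz inside `M'` produces the double
integral. -/
theorem norm_sq_average_le {f : ℝ → ℂ} (hf : Continuous f) {ε l : ℝ} (hε : 0 < ε) (hl : ε ≤ l) :
    ‖ε⁻¹ • ∫ u in (0 : ℝ)..ε, f u‖ ^ 2 ≤ 2 * (l⁻¹ * ∫ u in (0 : ℝ)..l, ‖f u‖ ^ 2) +
      2 * (Real.log (l / ε) *
        ∫ r in ε..l, (r ^ 2)⁻¹ * ∫ u in (0 : ℝ)..r, ‖f r - f u‖ ^ 2) := by
  have hl0 : 0 < l := hε.trans_le hl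
  set M : ℝ → ℂ := fun r => r⁻¹ • ∫ u in (0 : ℝ)..r, f u with hM
  set M' : ℝ → ℂ := fun r => (r ^ 2)⁻¹ • ∫ u in (0 : ℝ)..r, (f r - f u) with hM'
  have pos : ∀ r ∈ Icc ε l, 0 < r := fun r hr => hε.trans_le hr.1
  have c0 : ContinuousOn (fun r : ℝ => r⁻¹) (Icc ε l) :=
    continuousOn_inv₀.mono fun r hr => (pos r hr).ne'
  have c2 : ContinuousOn (fun r : ℝ => (r ^ 2)⁻¹) (Icc ε l) :=
    (continuousOn_pow 2).inv₀ fun r hr => (pow_pos (pos r hr) 2).ne'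
  have cM' : ContinuousOn M' (Icc ε l) := by
    refine c2.smul (Continuous.continuousOn ?_)
    exact intervalIntegral.continuous_parametric_intervalIntegral_of_continuous
      (f := fun r u => f r - f u) (by fun_prop) continuous_id
  have cq : Continuous fun r : ℝ => ∫ u in (0 : ℝ)..r, ‖f r - f u‖ ^ 2 :=
    intervalIntegral.continuous_parametric_intervalIntegral_of_continuous
      (f := fun r u => ‖f r - f u‖ ^ 2) (by fun_prop) continuous_id
  have ftc : M l - M ε = ∫ r in ε..l, M' r := by
    refine (intervalIntegral.integral_eq_sub_of_hasDerivAt (fun r hr => ?_) ?_).symm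
    · rw [uIcc_of_le hl] at hr
      exact hasDerivAt_running_average hf (pos r hr)
    · exact cM'.intervalIntegrable_of_Icc hl
  have hlog : ∫ r in ε..l, r⁻¹ = Real.log (l / ε) := integral_inv_of_pos hε hl0
  have hdiff : ‖M l - M ε‖ ^ 2 ≤ Real.log (l / ε) *
        ∫ r in ε..l, (r ^ 2)⁻¹ * ∫ u in (0 : ℝ)..r, ‖f r - f u‖ ^ 2 := by
    have h1 : ‖M l - M ε‖ ≤ ∫ r in ε..l, √(r⁻¹) * (√r * ‖M' r‖) := by
      rw [ftc]
      refine (intervalIntegral.norm_integral_le_integral_norm hl).trans_eq ?_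
      refine intervalIntegral.integral_congr fun r hr => ?_
      rw [uIcc_of_le hl] at hr
      have := pos r hr
      have h : √(r⁻¹) * √r = 1 := by
        rw [← Real.sqrt_mul (by positivity), inv_mul_cancel₀ this.ne', Real.sqrt_one]
      change _ = √(r⁻¹) * (√r * ‖M' r‖)
      rw [← mul_assoc, h, one_mul]
    have h2 := sq_intervalIntegral_mul_le hl (f := fun r => √(r⁻¹))
      (g := fun r => √r * ‖M' r‖) c0.sqrt (by fun_prop)
    have h3 : ∫ r in ε..l, √(r⁻¹) ^ 2 = Real.log (l / ε) := by
      rw [← hlog]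
      refine intervalIntegral.integral_congr fun r hr => ?_
      rw [uIcc_of_le hl] at hr
      exact Real.sq_sqrt (inv_nonneg.2 (pos r hr).le)
    have h4 : ∫ r in ε..l, (√r * ‖M' r‖) ^ 2 ≤
        ∫ r in ε..l, (r ^ 2)⁻¹ * ∫ u in (0 : ℝ)..r, ‖f r - f u‖ ^ 2 := by
      refine intervalIntegral.integral_mono_on hl ?_ ?_ fun r hr => ?_
      · exact ContinuousOn.intervalIntegrable_of_Icc hl (by fun_prop)
      · exact (c2.mul cq.continuousOn).intervalIntegrable_of_Icc hl
      have hr0 := pos r hr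
      have h5 := norm_intervalIntegral_sq_le hr0.le (f := fun u => f r - f u)
        (by fun_prop)
      rw [mul_pow, Real.sq_sqrt hr0.le, hM', norm_smul, mul_pow, Real.norm_of_nonneg
        (by positivity)]
      calc r * (((r ^ 2)⁻¹) ^ 2 * ‖∫ u in (0 : ℝ)..r, (f r - f u)‖ ^ 2)
          ≤ r * (((r ^ 2)⁻¹) ^ 2 * ((r - 0) * ∫ u in (0 : ℝ)..r, ‖f r - f u‖ ^ 2)) := by gcongr
        _ = _ := by field_simp; ring
    calc ‖M l - M ε‖ ^ 2 ≤ (∫ r in ε..l, √(r⁻¹) * (√r * ‖M' r‖)) ^ 2 := by gcongr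
      _ ≤ _ := h2
      _ ≤ _ := by
        rw [h3]
        exact mul_le_mul_of_nonneg_left h4 (Real.log_nonneg ((one_le_div hε).2 hl))
  have hMl : ‖M l‖ ^ 2 ≤ l⁻¹ * ∫ u in (0 : ℝ)..l, ‖f u‖ ^ 2 := by
    have h5 := norm_intervalIntegral_sq_le hl0.le hf.continuousOn
    rw [hM, norm_smul, mul_pow, Real.norm_of_nonneg (by positivity)]
    calc (l⁻¹) ^ 2 * ‖∫ u in (0 : ℝ)..l, f u‖ ^ 2
        ≤ (l⁻¹) ^ 2 * ((l - 0) * ∫ u in (0 : ℝ)..l, ‖f u‖ ^ 2) := by gcongr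
      _ = _ := by field_simp; ring
  have htri : ‖M ε‖ ≤ ‖M l‖ + ‖M l - M ε‖ := by
    have := norm_sub_le (M l) (M l - M ε)
    simpa using this
  change ‖M ε‖ ^ 2 ≤ _
  nlinarith [sq_nonneg (‖M l‖ - ‖M l - M ε‖), norm_nonneg (M ε)]

/-- A Gagliardo type `H^{1/2}` energy on `[α, β]`, regularised at scale `ε`. -/
noncomputable def gagliardo (α β ε : ℝ) (f : ℝ → ℂ) : ℝ≥0∞ :=
  ∫⁻ r in Icc α β, ∫⁻ u in Icc α β, ENNReal.ofReal (((|r - u| + ε) ^ 2)⁻¹) * ‖f r - f u‖ₑ ^ 2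

theorem measurable_gagliardo_kernel (ε : ℝ) :
    Measurable fun p : ℝ × ℝ => ENNReal.ofReal (((|p.1 - p.2| + ε) ^ 2)⁻¹) := by
  have : Measurable fun p : ℝ × ℝ => |p.1 - p.2| :=
    (continuous_abs.comp (continuous_fst.sub continuous_snd)).measurable
  fun_prop

theorem setLIntegral_comp_le {e : ℝ → ℝ} (he : MeasurePreserving e) {A B : Set ℝ}
    (hB : MeasurableSet B) (hAB : MapsTo e A B) {Φ : ℝ → ℝ≥0∞} (hΦ : Measurable Φ) :
    ∫⁻ u in A, Φ (e u) ≤ ∫⁻ u in B, Φ u := by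
  rw [← he.setLIntegral_comp_preimage hB hΦ]
  exact lintegral_mono_set hAB

theorem setLIntegral_setLIntegral_comp_le {e : ℝ → ℝ} (he : MeasurePreserving e) {A B : Set ℝ}
    (hB : MeasurableSet B) (hAB : MapsTo e A B) {Φ : ℝ × ℝ → ℝ≥0∞} (hΦ : Measurable Φ) :
    ∫⁻ r in A, ∫⁻ u in A, Φ (e r, e u) ≤ ∫⁻ r in B, ∫⁻ u in B, Φ (r, u) :=
  (lintegral_mono fun r => setLIntegral_comp_le he hB hAB (Φ := fun u => Φ (e r, u))
    (hΦ.comp measurable_prodMk_left)).trans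
    (setLIntegral_comp_le he hB hAB (Φ := fun r => ∫⁻ u in B, Φ (r, u)) hΦ.lintegral_prod_right')

theorem measurable_gagliardo_integrand (ε : ℝ) {f : ℝ → ℂ} (hf : Continuous f) :
    Measurable fun p : ℝ × ℝ =>
      ENNReal.ofReal (((|p.1 - p.2| + ε) ^ 2)⁻¹) * ‖f p.1 - f p.2‖ₑ ^ 2 := by
  refine (measurable_gagliardo_kernel ε).mul ?_
  have : Continuous fun p : ℝ × ℝ => f p.1 - f p.2 := by fun_prop
  exact (this.enorm.measurable).pow_const 2

theorem gagliardo_comp_le {e : ℝ → ℝ} (he : MeasurePreserving e) (hd : ∀ r u, |e r - e u| = |r - u|)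
    {α β l ε : ℝ} (hm : MapsTo e (Icc 0 l) (Icc α β)) {f : ℝ → ℂ} (hf : Continuous f) :
    gagliardo 0 l ε (f ∘ e) ≤ gagliardo α β ε f := by
  have := setLIntegral_setLIntegral_comp_le he measurableSet_Icc hm
    (measurable_gagliardo_integrand ε hf)
  simpa only [gagliardo, hd, Function.comp_apply] using this

theorem ofReal_norm_sq (z : ℂ) : ENNReal.ofReal (‖z‖ ^ 2) = ‖z‖ₑ ^ 2 := by
  rw [ENNReal.ofReal_pow (norm_nonneg _), ofReal_norm]

theorem ofReal_intervalIntegral_norm_sq {a b : ℝ} (hab : a ≤ b) {f : ℝ → ℂ} (hf : Continuous f) :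
    ENNReal.ofReal (∫ u in a..b, ‖f u‖ ^ 2) = ∫⁻ u in Ioc a b, ‖f u‖ₑ ^ 2 := by
  rw [intervalIntegral.integral_of_le hab, ofReal_integral_eq_lintegral_ofReal]
  · simp_rw [ofReal_norm_sq]
  · exact (Continuous.integrableOn_Icc (by fun_prop)).mono_set Ioc_subset_Icc_self
  · exact Filter.Eventually.of_forall fun u => by positivity

theorem enorm_sq_average_le {f : ℝ → ℂ} (hf : Continuous f) {ε l : ℝ} (hε : 0 < ε) (hl : ε ≤ l) :
    ‖ε⁻¹ • ∫ u in (0 : ℝ)..ε, f u‖ₑ ^ 2 ≤ ENNReal.ofReal (2 * l⁻¹) * (∫⁻ u in Icc 0 l, ‖f u‖ₑ ^ 2) +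
      ENNReal.ofReal (8 * Real.log (l / ε)) * gagliardo 0 l ε f := by
  have hl0 : 0 < l := hε.trans_le hl
  have hlog : 0 ≤ Real.log (l / ε) := Real.log_nonneg ((one_le_div hε).2 hl)
  have cq : Continuous fun r : ℝ => ∫ u in (0 : ℝ)..r, ‖f r - f u‖ ^ 2 :=
    intervalIntegral.continuous_parametric_intervalIntegral_of_continuous
      (f := fun r u => ‖f r - f u‖ ^ 2) (by fun_prop) continuous_id
  have c2 : ContinuousOn (fun r : ℝ => (r ^ 2)⁻¹) (Icc ε l) :=
    (continuousOn_pow 2).inv₀ fun r hr => (pow_pos (hε.trans_le hr.1) 2).ne'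
  have h := ENNReal.ofReal_le_ofReal (norm_sq_average_le hf hε hl)
  rw [ofReal_norm_sq] at h
  refine h.trans (ENNReal.ofReal_add_le.trans (add_le_add ?_ ?_))
  · rw [← mul_assoc, ENNReal.ofReal_mul (by positivity), ofReal_intervalIntegral_norm_sq hl0.le hf]
    gcongr
    exact Ioc_subset_Icc_self
  · rw [show (8 : ℝ) * Real.log (l / ε) = 2 * Real.log (l / ε) * 4 by ring, ← mul_assoc,
      ENNReal.ofReal_mul (by positivity),
      ENNReal.ofReal_mul (p := 2 * Real.log (l / ε)) (q := 4) (by positivity),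
      mul_assoc (ENNReal.ofReal _) (ENNReal.ofReal 4)]
    gcongr
    rw [intervalIntegral.integral_of_le hl, ofReal_integral_eq_lintegral_ofReal]
    · unfold gagliardo
      rw [← lintegral_const_mul' _ _ ENNReal.ofReal_ne_top]
      refine (setLIntegral_mono' measurableSet_Ioc (g := fun r => ENNReal.ofReal 4 *
        ∫⁻ u in Icc 0 l, ENNReal.ofReal (((|r - u| + ε) ^ 2)⁻¹) * ‖f r - f u‖ₑ ^ 2)
        fun r hr => ?_).trans
        (lintegral_mono_set (Ioc_subset_Icc_self.trans (Icc_subset_Icc_left hε.le)))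
      have hr0 : 0 < r := hε.trans hr.1
      rw [ENNReal.ofReal_mul (by positivity),
        ofReal_intervalIntegral_norm_sq (f := fun u => f r - f u) hr0.le (by fun_prop),
        ← lintegral_const_mul' _ _ ENNReal.ofReal_ne_top,
        ← lintegral_const_mul' _ _ ENNReal.ofReal_ne_top]
      refine (setLIntegral_mono' measurableSet_Ioc (g := fun u => ENNReal.ofReal 4 *
        (ENNReal.ofReal (((|r - u| + ε) ^ 2)⁻¹) * ‖f r - f u‖ₑ ^ 2)) fun u hu => ?_).trans
        (lintegral_mono_set (Ioc_subset_Icc_self.trans (Icc_subset_Icc_right hr.2)))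
      rw [← mul_assoc, ← ENNReal.ofReal_mul (by norm_num)]
      gcongr
      -- Since `0 < u ≤ r` and `ε < r`, the weight `r⁻²` is at most four times the regularised
      -- kernel; hence the constant `8 = 2 * 4`.
      have h1 : |r - u| + ε ≤ 2 * r := by
        rw [abs_of_nonneg (by linarith [hu.2])]
        linarith [hu.1, hr.1]
      have h2 : (|r - u| + ε) ^ 2 ≤ 4 * r ^ 2 := by
        calc (|r - u| + ε) ^ 2 ≤ (2 * r) ^ 2 := by gcongr
          _ = _ := by ring
      have h3 : (r ^ 2)⁻¹ = 4 * (4 * r ^ 2)⁻¹ := by field_simp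
      rw [h3]
      gcongr
    · exact ((c2.mul cq.continuousOn).integrableOn_Icc).mono_set Ioc_subset_Icc_self
    · refine (ae_restrict_iff' measurableSet_Ioc).2 (Filter.Eventually.of_forall fun r hr => ?_)
      exact mul_nonneg (by positivity)
        (intervalIntegral.integral_nonneg (hε.trans hr.1).le fun _ _ => by positivity)

/-- One-sided averages of a continuous function at scale `ε` are controlled, up to a logarithm, by
its `H^{1/2}` energy. -/
theorem exists_enorm_sq_average_le {f : ℝ → ℂ} (hf : Continuous f) {α β ε s : ℝ} (hε : 0 < ε)
    (hl : ε ≤ (β - α) / 2) (hs : s ∈ Icc α β) :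
    ∃ σ : ℝ, |σ| = 1 ∧ (∀ u ∈ Icc 0 ε, s + σ * u ∈ Icc α β) ∧
      ‖ε⁻¹ • ∫ u in (0 : ℝ)..ε, f (s + σ * u)‖ₑ ^ 2 ≤
        ENNReal.ofReal (4 / (β - α)) * (∫⁻ u in Icc α β, ‖f u‖ₑ ^ 2) +
        ENNReal.ofReal (8 * Real.log ((β - α) / 2 / ε)) * gagliardo α β ε f := by
  have main : ∀ σ : ℝ, |σ| = 1 → MeasurePreserving (fun u : ℝ => s + σ * u) →
      MapsTo (fun u : ℝ => s + σ * u) (Icc 0 ((β - α) / 2)) (Icc α β) → (∀ u ∈ Icc 0 ε,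
        s + σ * u ∈ Icc α β) ∧ ‖ε⁻¹ • ∫ u in (0 : ℝ)..ε, f (s + σ * u)‖ₑ ^ 2 ≤
        ENNReal.ofReal (4 / (β - α)) * (∫⁻ u in Icc α β, ‖f u‖ₑ ^ 2) +
        ENNReal.ofReal (8 * Real.log ((β - α) / 2 / ε)) * gagliardo α β ε f := by
    intro σ hσ he hm
    refine ⟨fun u hu => hm (Icc_subset_Icc_right hl hu), ?_⟩
    refine (enorm_sq_average_le (f := fun u => f (s + σ * u)) (by fun_prop) hε hl).trans ?_
    rw [show 2 * ((β - α) / 2)⁻¹ = 4 / (β - α) by field_simp; norm_num]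
    refine add_le_add (mul_le_mul_right ?_ _) (mul_le_mul_right ?_ _)
    · exact setLIntegral_comp_le he measurableSet_Icc hm (Φ := fun u => ‖f u‖ₑ ^ 2)
        (hf.enorm.measurable.pow_const 2)
    · refine gagliardo_comp_le he (fun r u => ?_) hm hf
      rw [show s + σ * r - (s + σ * u) = σ * (r - u) by ring, abs_mul, hσ, one_mul]
  -- Average towards the farther endpoint, so that a whole half-length `(β - α) / 2` fits inside the
  -- interval.
  rcases le_total s ((α + β) / 2) with h | h
  · refine ⟨1, by simp, main 1 (by simp) ?_ ?_⟩
    · simpa using measurePreserving_add_left volume s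
    · intro u hu
      constructor <;> linarith [hs.1, hs.2, hu.1, hu.2]
  · refine ⟨-1, by simp, main (-1) (by simp) ?_ ?_⟩
    · simpa [sub_eq_add_neg] using Measure.measurePreserving_sub_left volume s
    · intro u hu
      constructor <;> linarith [hs.1, hs.2, hu.1, hu.2]

end OneDim

end Nikodym

namespace Nikodym

/-! ### Counting zeros by Rolle's theorem, and change of variables on monotone pieces. -/

section Zeros

/-- If the `m`-th derivative of a function does not vanish on an open interval, then the function
has at most `m` zeros there. The successive derivatives are `H 0, H 1, …`. -/
theorem exists_finset_zeros {α β : ℝ} (m : ℕ) : ∀ (H : ℕ → ℝ → ℝ), (∀ j, Continuous (H j)) →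
    (∀ j, ∀ s ∈ Ioo α β, HasDerivAt (H j) (H (j + 1) s) s) → (∀ s ∈ Ioo α β, H m s ≠ 0) →
    ∃ Z : Finset ℝ, Z.card ≤ m ∧ ∀ s ∈ Ioo α β, H 0 s = 0 → s ∈ Z := by
  induction m with
  | zero => exact fun H _ _ h0 => ⟨∅, by simp, fun s hs h => absurd h (h0 s hs)⟩
  | succ m ih =>
    intro H hc hd hm
    obtain ⟨Z', hZ', hz⟩ := ih (fun j => H (j + 1)) (fun j => hc _) (fun j => hd _) hm
    -- By Rolle, a zero of `H 1` lies strictly between any two zeros of `H 0`. The count is made for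
    -- finite sets of zeros first, since finiteness of the zero set is itself deduced from it.
    have key : ∀ S : Finset ℝ, (S : Set ℝ) ⊆ {s | s ∈ Ioo α β ∧ H 0 s = 0} → S.card ≤ m + 1 := by
      intro S hS
      refine (Finset.card_le_of_interleaved (t := Z') fun x hx y hy hxy _ => ?_).trans
        (by omega)
      obtain ⟨hxI, hx0⟩ := hS hx
      obtain ⟨hyI, hy0⟩ := hS hy
      have sub : ∀ z ∈ Ioo x y, z ∈ Ioo α β := fun z h => ⟨hxI.1.trans h.1, h.2.trans hyI.2⟩
      obtain ⟨c, hcI, hc0⟩ := exists_hasDerivAt_eq_zero hxy (hc 0).continuousOn (hx0.trans hy0.symm)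
        fun z h => hd 0 z (sub z h)
      exact ⟨c, hz c (sub c hcI) hc0, hcI.1, hcI.2⟩
    have fin : {s | s ∈ Ioo α β ∧ H 0 s = 0}.Finite := by
      by_contra hinf
      obtain ⟨S, hS, hcard⟩ := Set.Infinite.exists_subset_card_eq hinf (m + 2)
      have := key S hS
      omega
    refine ⟨fin.toFinset, key _ (by simp), fun s hs h => ?_⟩
    simpa using ⟨hs, h⟩

theorem nonneg_or_nonpos_of_ne_zero {φ : ℝ → ℝ} (hφ : Continuous φ) {a b : ℝ}
    (h0 : ∀ s ∈ Ioo a b, φ s ≠ 0) :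
    (∀ s ∈ Icc a b, 0 ≤ φ s) ∨ ∀ s ∈ Icc a b, φ s ≤ 0 := by
  by_contra hcon
  push Not at hcon
  obtain ⟨⟨x, hx, hx0⟩, y, hy, hy0⟩ := hcon
  rcases lt_trichotomy x y with h | h | h
  · obtain ⟨c, hc, hc0⟩ := intermediate_value_Ioo h.le hφ.continuousOn ⟨hx0, hy0⟩
    exact h0 c ⟨hx.1.trans_lt hc.1, hc.2.trans_le hy.2⟩ hc0
  · subst h
    linarith
  · obtain ⟨c, hc, hc0⟩ := intermediate_value_Ioo' h.le hφ.continuousOn ⟨hx0, hy0⟩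
    exact h0 c ⟨hy.1.trans_lt hc.1, hc.2.trans_le hx.2⟩ hc0

/-- A monotone `h` covers the interval between `h a` and `h b` once, so the substitution `u = h s`
leaves at most the full integral of `Φ`. -/
theorem intervalIntegral_abs_deriv_mul_comp_le_of_sign {h h' Φ : ℝ → ℝ} (hh : Continuous h)
    (hh' : Continuous h') {a b : ℝ} (hab : a ≤ b) (hd : ∀ s ∈ Ioo a b, HasDerivAt h (h' s) s)
    (hs : (∀ s ∈ Icc a b, 0 ≤ h' s) ∨ ∀ s ∈ Icc a b, h' s ≤ 0)
    (hΦ : Continuous Φ) (hΦ0 : ∀ u, 0 ≤ Φ u) (hi : Integrable Φ) :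
    ∫ s in a..b, |h' s| * Φ (h s) ≤ ∫ u, Φ u := by
  have cv : ∫ s in a..b, (Φ ∘ h) s * h' s = ∫ u in h a..h b, Φ u := by
    refine intervalIntegral.integral_comp_mul_deriv''' hh.continuousOn (fun x hx => ?_)
      hΦ.continuousOn hi.integrableOn ?_
    · rw [min_eq_left hab, max_eq_right hab] at hx
      exact (hd x hx).hasDerivWithinAt
    · exact Continuous.integrableOn_uIcc (by fun_prop)
  have hb : |∫ u in h a..h b, Φ u| ≤ ∫ u, Φ u := by
    have h1 := intervalIntegral.norm_integral_le_integral_norm_uIoc (a := h a) (b := h b)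
      (f := Φ) (μ := volume)
    simp_rw [Real.norm_of_nonneg (hΦ0 _)] at h1
    exact h1.trans (setIntegral_le_integral hi (Filter.Eventually.of_forall hΦ0))
  have e : ∫ s in a..b, |h' s| * Φ (h s) = |∫ s in a..b, (Φ ∘ h) s * h' s| := by
    rcases hs with hs | hs
    · have h0 : 0 ≤ ∫ s in a..b, (Φ ∘ h) s * h' s := intervalIntegral.integral_nonneg hab
        fun s hsI => mul_nonneg (hΦ0 _) (hs s hsI)
      rw [abs_of_nonneg h0]
      refine intervalIntegral.integral_congr fun s hsI => ?_
      rw [uIcc_of_le hab] at hsI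
      simp only [Function.comp, abs_of_nonneg (hs s hsI), mul_comm]
    · have h0 : 0 ≤ ∫ s in a..b, -((Φ ∘ h) s * h' s) := intervalIntegral.integral_nonneg hab
        fun s hsI => neg_nonneg.2 (mul_nonpos_of_nonneg_of_nonpos (hΦ0 _) (hs s hsI))
      rw [← abs_neg, ← intervalIntegral.integral_neg, abs_of_nonneg h0]
      refine intervalIntegral.integral_congr fun s hsI => ?_
      rw [uIcc_of_le hab] at hsI
      simp only [Function.comp, abs_of_nonpos (hs s hsI)]
      ring
  rw [e, cv]
  exact hb

/-- Change of variables for a function whose derivative has finitely many zeros. -/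
theorem intervalIntegral_abs_deriv_mul_comp_le {h h' Φ : ℝ → ℝ} (hh : Continuous h)
    (hh' : Continuous h') {α β : ℝ} (hd : ∀ s ∈ Ioo α β, HasDerivAt h (h' s) s)
    {Z : Finset ℝ} (hZ : ∀ s ∈ Ioo α β, h' s = 0 → s ∈ Z)
    (hΦ : Continuous Φ) (hΦ0 : ∀ u, 0 ≤ Φ u) (hi : Integrable Φ) (n : ℕ) :
    ∀ a b, α ≤ a → a ≤ b → b ≤ β → (Z.filter (· ∈ Ioo a b)).card ≤ n →
    ∫ s in a..b, |h' s| * Φ (h s) ≤ (n + 1) * ∫ u, Φ u := by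
  have hI : 0 ≤ ∫ u, Φ u := integral_nonneg hΦ0
  have hint (a b : ℝ) : IntervalIntegrable (fun s => |h' s| * Φ (h s)) volume a b :=
    Continuous.intervalIntegrable (by fun_prop) _ _
  induction n with
  | zero =>
    intro a b ha hab hb hn
    have hsub : ∀ s ∈ Ioo a b, s ∈ Ioo α β := fun s hs => ⟨ha.trans_lt hs.1, hs.2.trans_le hb⟩
    simp only [Nat.cast_zero, zero_add, one_mul]
    refine intervalIntegral_abs_deriv_mul_comp_le_of_sign hh hh' hab (fun s hs => hd s (hsub s hs))
      (nonneg_or_nonpos_of_ne_zero hh' fun s hs h0 => ?_) hΦ hΦ0 hi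
    have : s ∈ Z.filter (· ∈ Ioo a b) := Finset.mem_filter.2 ⟨hZ s (hsub s hs) h0, hs⟩
    rw [Finset.card_eq_zero.1 (Nat.le_zero.1 hn)] at this
    exact absurd this (Finset.notMem_empty s)
  | succ n ih =>
    intro a b ha hab hb hn
    rcases (Z.filter (· ∈ Ioo a b)).eq_empty_or_nonempty with he | hne
    · have := ih a b ha hab hb (by rw [he]; simp)
      push_cast
      linarith
    -- Cut at the leftmost zero: `h'` keeps its sign to the left of it, and one zero fewer remains
    -- on the right.
    · set z := (Z.filter (· ∈ Ioo a b)).min' hne with hz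
      have hzm := Finset.min'_mem _ hne
      rw [← hz, Finset.mem_filter] at hzm
      obtain ⟨hzZ, hza, hzb⟩ := hzm
      have h1 : ∫ s in a..z, |h' s| * Φ (h s) ≤ ∫ u, Φ u := by
        have hsub : ∀ s ∈ Ioo a z, s ∈ Ioo α β :=
          fun s hs => ⟨ha.trans_lt hs.1, hs.2.trans (hzb.trans_le hb)⟩
        refine intervalIntegral_abs_deriv_mul_comp_le_of_sign hh hh' hza.le
          (fun s hs => hd s (hsub s hs))
          (nonneg_or_nonpos_of_ne_zero hh' fun s hs h0 => ?_) hΦ hΦ0 hi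
        have : s ∈ Z.filter (· ∈ Ioo a b) :=
          Finset.mem_filter.2 ⟨hZ s (hsub s hs) h0, hs.1, hs.2.trans hzb⟩
        exact absurd (Finset.min'_le _ _ this) (not_le.2 hs.2)
      have h2 := ih z b (ha.trans hza.le) hzb.le hb (by
        have hss : Z.filter (· ∈ Ioo z b) ⊆ (Z.filter (· ∈ Ioo a b)).erase z := by
          intro s hs
          rw [Finset.mem_filter] at hs
          exact Finset.mem_erase.2 ⟨hs.2.1.ne', Finset.mem_filter.2 ⟨hs.1, hza.trans hs.2.1, hs.2.2⟩⟩
        have := Finset.card_le_card hss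
        rw [Finset.card_erase_of_mem (Finset.mem_filter.2 ⟨hzZ, hza, hzb⟩)] at this
        omega)
      rw [← intervalIntegral.integral_add_adjacent_intervals (hint a z) (hint z b)]
      push_cast
      linarith

theorem setLIntegral_abs_deriv_mul_comp_le {h h' : ℝ → ℝ} (hh : Continuous h)
    (hh' : Continuous h') {α β : ℝ} (hαβ : α ≤ β) (hd : ∀ s ∈ Ioo α β, HasDerivAt h (h' s) s)
    {Z : Finset ℝ} (hZ : ∀ s ∈ Ioo α β, h' s = 0 → s ∈ Z) {G : ℝ → ℂ} (hG : Continuous G)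
    {n : ℕ} (hn : Z.card + 1 ≤ n) {B : ℝ≥0∞} (hB : B ≠ ⊤) (hGB : ∫⁻ u, ‖G u‖ₑ ^ 2 ≤ B) :
    ∫⁻ s in Icc α β, ENNReal.ofReal |h' s| * ‖G (h s)‖ₑ ^ 2 ≤ n * B := by
  have e1 : ∀ u, ‖G u‖ₑ ^ 2 = ENNReal.ofReal (‖G u‖ ^ 2) := fun u => (ofReal_norm_sq _).symm
  have hi : Integrable fun u => ‖G u‖ ^ 2 := by
    refine ⟨(hG.norm.pow 2).aestronglyMeasurable, ?_⟩
    rw [hasFiniteIntegral_iff_ofReal (Filter.Eventually.of_forall fun u => by positivity)]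
    simp_rw [← e1]
    exact hGB.trans_lt hB.lt_top
  have h1 := intervalIntegral_abs_deriv_mul_comp_le hh hh' hd hZ (Φ := fun u => ‖G u‖ ^ 2)
    (by fun_prop) (fun u => by positivity) hi Z.card α β le_rfl hαβ le_rfl
    (Finset.card_filter_le _ _)
  have h2 := ENNReal.ofReal_le_ofReal h1
  rw [ENNReal.ofReal_mul (by positivity), intervalIntegral.integral_of_le hαβ,
    ofReal_integral_eq_lintegral_ofReal, ofReal_integral_eq_lintegral_ofReal hi] at h2
  · simp_rw [← e1] at h2
    rw [setLIntegral_congr Ioc_ae_eq_Icc.symm]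
    calc ∫⁻ s in Ioc α β, ENNReal.ofReal |h' s| * ‖G (h s)‖ₑ ^ 2
        = ∫⁻ s in Ioc α β, ENNReal.ofReal (|h' s| * ‖G (h s)‖ ^ 2) := by
          simp_rw [ENNReal.ofReal_mul (abs_nonneg _), e1]
      _ ≤ _ := h2
      _ ≤ n * B := by
        gcongr
        rw [show (Z.card : ℝ) + 1 = ((Z.card + 1 : ℕ) : ℝ) by push_cast; ring,
          ENNReal.ofReal_natCast]
        exact_mod_cast hn
  · exact Filter.Eventually.of_forall fun u => by positivity
  · exact (Continuous.integrableOn_Icc (by fun_prop)).mono_set Ioc_subset_Icc_self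
  · exact Filter.Eventually.of_forall fun u => by positivity

end Zeros

end Nikodym

namespace Nikodym

/-! ### Mean-square increments of `G ∘ h`. -/

section Composition

theorem enorm_sub_sq_le (x y : ℂ) : ‖x - y‖ₑ ^ 2 ≤ 2 * ‖x‖ₑ ^ 2 + 2 * ‖y‖ₑ ^ 2 := by
  rw [← ofReal_norm_sq, ← ofReal_norm_sq, ← ofReal_norm_sq, ← ENNReal.ofReal_ofNat,
    ← ENNReal.ofReal_mul (by norm_num), ← ENNReal.ofReal_mul (by norm_num),
    ← ENNReal.ofReal_add (by positivity) (by positivity)]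
  apply ENNReal.ofReal_le_ofReal
  have := norm_sub_le x y
  nlinarith [norm_nonneg x, norm_nonneg y, norm_nonneg (x - y), sq_nonneg (‖x‖ - ‖y‖)]

theorem setLIntegral_shift_le {ψ : ℝ → ℝ≥0∞} (hψ : Measurable ψ) {α β v r : ℝ}
    (hr0 : 0 ≤ r) (hrv : r ≤ v) :
    ∫⁻ s in Icc α (β - v), ψ (s + r) ≤ ∫⁻ s in Icc α β, ψ s :=
  setLIntegral_comp_le (measurePreserving_add_right volume r) measurableSet_Icc
    (fun s hs => ⟨by linarith [hs.1], by linarith [hs.2]⟩) hψ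

theorem setLIntegral_setLIntegral_shift_le {ψ : ℝ → ℝ≥0∞} (hψ : Measurable ψ) {α β v : ℝ} :
    ∫⁻ s in Icc α (β - v), ∫⁻ r in Ioc 0 v, ψ (s + r) ≤
      ENNReal.ofReal v * ∫⁻ s in Icc α β, ψ s := by
  rw [lintegral_lintegral_swap (by
    have : Measurable fun p : ℝ × ℝ => ψ (p.1 + p.2) := by fun_prop
    exact this.aemeasurable)]
  calc ∫⁻ r in Ioc 0 v, ∫⁻ s in Icc α (β - v), ψ (s + r)
      ≤ ∫⁻ _ in Ioc 0 v, ∫⁻ s in Icc α β, ψ s :=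
        setLIntegral_mono' measurableSet_Ioc fun r hr => setLIntegral_shift_le hψ hr.1.le hr.2
    _ = _ := by simp [mul_comm]

variable {h h' : ℝ → ℝ} {G G' : ℝ → ℂ} {α β : ℝ}

/-- Fundamental theorem of calculus and Cauchy–Schwarz. Only one of the two factors `|h'|` is
replaced by its bound `T`; the other is kept as the Jacobian for the later substitution `u = h s`.
-/
theorem enorm_sq_comp_sub_le (hh : Continuous h) (hh' : Continuous h')
    (hd : ∀ s ∈ Ioo α β, HasDerivAt h (h' s) s) (hG : ∀ u, HasDerivAt G (G' u) u)
    (hG' : Continuous G') {s v T : ℝ} (hv : 0 ≤ v) (hs : α ≤ s) (hsv : s + v ≤ β)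
    (hT : ∀ r ∈ Icc s (s + v), |h' r| ≤ T) :
    ‖G (h (s + v)) - G (h s)‖ₑ ^ 2 ≤ ENNReal.ofReal (v * T) *
      ∫⁻ r in Ioc 0 v, ENNReal.ofReal |h' (s + r)| * ‖G' (h (s + r))‖ₑ ^ 2 := by
  have hle : s ≤ s + v := by linarith
  have hT0 : 0 ≤ T := (abs_nonneg _).trans (hT s ⟨le_rfl, hle⟩)
  have hGc : Continuous G := continuous_iff_continuousAt.2 fun u => (hG u).continuousAt
  have ftc : ∫ r in s..s + v, h' r • G' (h r) = G (h (s + v)) - G (h s) := by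
    refine intervalIntegral.integral_eq_sub_of_hasDerivAt_of_le hle (f := fun r => G (h r))
      (by fun_prop) (fun r hr => ?_) (Continuous.intervalIntegrable (by fun_prop) _ _)
    exact (hG (h r)).scomp r (hd r ⟨hs.trans_lt hr.1, hr.2.trans_le hsv⟩)
  have h1 := norm_intervalIntegral_sq_le hle (f := fun r => h' r • G' (h r)) (by fun_prop)
  rw [ftc, add_sub_cancel_left] at h1
  have h2 : ∫ r in s..s + v, ‖h' r • G' (h r)‖ ^ 2 ≤ T * ∫ r in s..s + v, |h' r| * ‖G' (h r)‖ ^ 2 := by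
    rw [← intervalIntegral.integral_const_mul]
    refine intervalIntegral.integral_mono_on hle (Continuous.intervalIntegrable (by fun_prop) _ _)
      (Continuous.intervalIntegrable (by fun_prop) _ _) fun r hr => ?_
    rw [norm_smul, mul_pow, Real.norm_eq_abs, sq |h' r|, mul_assoc]
    exact mul_le_mul_of_nonneg_right (hT r hr) (by positivity)
  have h3 : ∫ r in s..s + v, |h' r| * ‖G' (h r)‖ ^ 2 =
      ∫ r in (0 : ℝ)..v, |h' (s + r)| * ‖G' (h (s + r))‖ ^ 2 := by
    rw [intervalIntegral.integral_comp_add_left (fun r => |h' r| * ‖G' (h r)‖ ^ 2) s, add_zero]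
  rw [← ofReal_norm_sq]
  refine (ENNReal.ofReal_le_ofReal (h1.trans (mul_le_mul_of_nonneg_left h2 hv))).trans ?_
  rw [h3, ← mul_assoc, ENNReal.ofReal_mul (by positivity), intervalIntegral.integral_of_le hv,
    ofReal_integral_eq_lintegral_ofReal]
  · simp_rw [ENNReal.ofReal_mul (abs_nonneg _), ofReal_norm_sq]
    exact le_rfl
  · exact (Continuous.integrableOn_Icc (by fun_prop)).mono_set Ioc_subset_Icc_self
  · exact Filter.Eventually.of_forall fun u => by positivity

theorem measurable_abs_mul_enorm_sq (hh : Continuous h) (hh' : Continuous h') (hG : Continuous G) :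
    Measurable fun s => ENNReal.ofReal |h' s| * ‖G (h s)‖ₑ ^ 2 := by
  have h1 : Continuous fun s => G (h s) := by fun_prop
  exact (ENNReal.measurable_ofReal.comp hh'.abs.measurable).mul (h1.enorm.measurable.pow_const 2)

theorem setLIntegral_increment_le_of_abs_deriv_le (hh : Continuous h) (hh' : Continuous h')
    (hd : ∀ s ∈ Ioo α β, HasDerivAt h (h' s) s) (hG : ∀ u, HasDerivAt G (G' u) u)
    (hG' : Continuous G') {v T : ℝ} (hv : 0 ≤ v) (hT0 : 0 ≤ T)
    (hT : ∀ r ∈ Icc α β, |h' r| ≤ T) :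
    ∫⁻ s in Icc α (β - v), ‖G (h (s + v)) - G (h s)‖ₑ ^ 2 ≤ ENNReal.ofReal (v ^ 2 * T) *
      ∫⁻ s in Icc α β, ENNReal.ofReal |h' s| * ‖G' (h s)‖ₑ ^ 2 := by
  have hm := measurable_abs_mul_enorm_sq hh hh' hG'
  calc ∫⁻ s in Icc α (β - v), ‖G (h (s + v)) - G (h s)‖ₑ ^ 2
      ≤ ∫⁻ s in Icc α (β - v), ENNReal.ofReal (v * T) *
          ∫⁻ r in Ioc 0 v, ENNReal.ofReal |h' (s + r)| * ‖G' (h (s + r))‖ₑ ^ 2 := by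
        refine setLIntegral_mono' measurableSet_Icc fun s hs => ?_
        exact enorm_sq_comp_sub_le hh hh' hd hG hG' hv hs.1 (by linarith [hs.2])
          fun r hr => hT r ⟨hs.1.trans hr.1, by linarith [hr.2, hs.2]⟩
    _ ≤ ENNReal.ofReal (v * T) * (ENNReal.ofReal v *
          ∫⁻ s in Icc α β, ENNReal.ofReal |h' s| * ‖G' (h s)‖ₑ ^ 2) := by
        rw [lintegral_const_mul' _ _ ENNReal.ofReal_ne_top]
        gcongr
        exact setLIntegral_setLIntegral_shift_le hm
    _ = _ := by
        rw [← mul_assoc, ← ENNReal.ofReal_mul (by positivity)]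
        congr 2
        ring

theorem setLIntegral_increment_le_two_mul (hh : Continuous h) (hG : Continuous G) {v : ℝ}
    (hv : 0 ≤ v) :
    ∫⁻ s in Icc α (β - v), ‖G (h (s + v)) - G (h s)‖ₑ ^ 2 ≤
      4 * ∫⁻ s in Icc α β, ‖G (h s)‖ₑ ^ 2 := by
  have hc : Continuous fun s => G (h s) := by fun_prop
  have hm : Measurable fun s => ‖G (h s)‖ₑ ^ 2 := hc.enorm.measurable.pow_const 2
  have hm' : Measurable fun s => ‖G (h (s + v))‖ₑ ^ 2 := hm.comp (measurable_add_const v)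
  calc ∫⁻ s in Icc α (β - v), ‖G (h (s + v)) - G (h s)‖ₑ ^ 2
      ≤ ∫⁻ s in Icc α (β - v), (2 * ‖G (h (s + v))‖ₑ ^ 2 + 2 * ‖G (h s)‖ₑ ^ 2) :=
        lintegral_mono fun s => enorm_sub_sq_le _ _
    _ = 2 * (∫⁻ s in Icc α (β - v), ‖G (h (s + v))‖ₑ ^ 2) +
          2 * ∫⁻ s in Icc α (β - v), ‖G (h s)‖ₑ ^ 2 := by
        rw [lintegral_add_left (hm'.const_mul 2), lintegral_const_mul _ hm',
          lintegral_const_mul _ hm]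
    _ ≤ 2 * (∫⁻ s in Icc α β, ‖G (h s)‖ₑ ^ 2) + 2 * ∫⁻ s in Icc α β, ‖G (h s)‖ₑ ^ 2 := by
        refine add_le_add (mul_le_mul_right (setLIntegral_shift_le hm hv le_rfl) _)
          (mul_le_mul_right (lintegral_mono_set (Icc_subset_Icc_right ?_)) _)
        linarith
    _ = _ := by
        rw [← two_mul, ← mul_assoc]
        norm_num

/-- Increments of `G ∘ h` in mean square, when `h'` crosses each of the levels `± 1 / v` a bounded
number of times. -/
theorem setLIntegral_increment_le_mul (hh : Continuous h) (hh' : Continuous h')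
    (hd : ∀ s ∈ Ioo α β, HasDerivAt h (h' s) s) (hG : ∀ u, HasDerivAt G (G' u) u)
    (hG' : Continuous G') {v : ℝ} (hv : 0 < v) {m : ℕ} {B : ℝ≥0∞}
    (hGB : ∀ u, ‖G u‖ₑ ^ 2 ≤ B)
    (h0 : ∫⁻ s in Icc α β, ENNReal.ofReal |h' s| * ‖G (h s)‖ₑ ^ 2 ≤ m * B)
    (h1 : ∫⁻ s in Icc α β, ENNReal.ofReal |h' s| * ‖G' (h s)‖ₑ ^ 2 ≤ m * B)
    (hcross : ∀ c : ℝ, ∃ Z : Finset ℝ, Z.card ≤ m ∧ ∀ s ∈ Ioo α β, h' s = c → s ∈ Z) :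
    ∫⁻ s in Icc α (β - v), ‖G (h (s + v)) - G (h s)‖ₑ ^ 2 ≤
      ENNReal.ofReal v * (13 * (m * B)) := by
  classical
  have hGc : Continuous G := continuous_iff_continuousAt.2 fun u => (hG u).continuousAt
  -- The level `1 / v` balances two estimates: if `|h'| ≤ 1 / v` on `[s, s + v]`, the prefactor `v *
  -- T` of the derivative bound is `1`; if `|h'| ≥ 1 / v`, then `|G ∘ h|² ≤ v |h'| |G ∘ h|²`.
  obtain ⟨Z₁, hc₁, hZ₁⟩ := hcross v⁻¹
  obtain ⟨Z₂, hc₂, hZ₂⟩ := hcross (-v⁻¹)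
  set Z := Z₁ ∪ Z₂ with hZ
  -- For the exceptional `s`, those with a crossing in `[s, s + v]`, the sup bound `4 * B` is used;
  -- each crossing accounts for a set of length `v`.
  set bad : ℝ → ℝ≥0∞ := fun s => ∑ z ∈ Z, (Icc (z - v) z).indicator (fun _ => 4 * B) s with hbad
  set ψ₀ : ℝ → ℝ≥0∞ := fun s => ENNReal.ofReal |h' s| * ‖G (h s)‖ₑ ^ 2 with hψ₀
  set ψ₁ : ℝ → ℝ≥0∞ := fun s => ENNReal.ofReal |h' s| * ‖G' (h s)‖ₑ ^ 2 with hψ₁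
  have m₀ : Measurable ψ₀ := measurable_abs_mul_enorm_sq hh hh' hGc
  have m₁ : Measurable ψ₁ := measurable_abs_mul_enorm_sq hh hh' hG'
  have mbad : Measurable bad :=
    Finset.measurable_fun_sum _ fun z _ => measurable_const.indicator measurableSet_Icc
  have pt : ∀ s ∈ Icc α (β - v), ‖G (h (s + v)) - G (h s)‖ₑ ^ 2 ≤
      bad s + (2 * ENNReal.ofReal v * ψ₀ (s + v) + (2 * ENNReal.ofReal v * ψ₀ s +
        ∫⁻ r in Ioc 0 v, ψ₁ (s + r))) := by
    intro s hs
    have hsv : s + v ≤ β := by linarith [hs.2]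
    by_cases hb : ∃ z ∈ Z, z ∈ Icc s (s + v)
    · obtain ⟨z, hzZ, hz⟩ := hb
      have e1 : 4 * B ≤ bad s := by
        refine le_trans ?_ (Finset.single_le_sum (f := fun z =>
          (Icc (z - v) z).indicator (fun _ => 4 * B) s) (fun _ _ => zero_le) hzZ)
        rw [indicator_of_mem]
        exact ⟨by linarith [hz.2], hz.1⟩
      refine (enorm_sub_sq_le _ _).trans (le_trans ?_ (e1.trans le_self_add))
      calc 2 * ‖G (h (s + v))‖ₑ ^ 2 + 2 * ‖G (h s)‖ₑ ^ 2 ≤ 2 * B + 2 * B := by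
            gcongr <;> exact hGB _
        _ = 4 * B := by rw [← add_mul]; norm_num
    · push Not at hb
      have sub : ∀ r ∈ Ioo s (s + v), r ∈ Ioo α β :=
        fun r hr => ⟨hs.1.trans_lt hr.1, hr.2.trans_le hsv⟩
      have s1 := nonneg_or_nonpos_of_ne_zero (φ := fun r => h' r - v⁻¹) (by fun_prop)
        (a := s) (b := s + v) fun r hr h0 => hb r (Finset.mem_union_left _
          (hZ₁ r (sub r hr) (by linarith))) (Ioo_subset_Icc_self hr)
      have s2 := nonneg_or_nonpos_of_ne_zero (φ := fun r => h' r + v⁻¹) (by fun_prop)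
        (a := s) (b := s + v) fun r hr h0 => hb r (Finset.mem_union_right _
          (hZ₂ r (sub r hr) (by linarith))) (Ioo_subset_Icc_self hr)
      have hvi : 0 < v⁻¹ := inv_pos.2 hv
      have alt : (∀ r ∈ Icc s (s + v), |h' r| ≤ v⁻¹) ∨ ∀ r ∈ Icc s (s + v), v⁻¹ ≤ |h' r| := by
        rcases s1 with s1 | s1
        · exact Or.inr fun r hr => le_abs.2 (Or.inl (by linarith [s1 r hr]))
        rcases s2 with s2 | s2
        · exact Or.inl fun r hr => abs_le.2 ⟨by linarith [s2 r hr], by linarith [s1 r hr]⟩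
        · exact Or.inr fun r hr => le_abs.2 (Or.inr (by linarith [s2 r hr]))
      rcases alt with alt | alt
      · have := enorm_sq_comp_sub_le hh hh' hd hG hG' hv.le hs.1 hsv alt
        rw [mul_inv_cancel₀ hv.ne', ENNReal.ofReal_one, one_mul] at this
        refine this.trans (le_trans ?_ le_add_self)
        exact le_add_self.trans le_add_self
      · have big : ∀ r ∈ Icc s (s + v), ‖G (h r)‖ₑ ^ 2 ≤ ENNReal.ofReal v * ψ₀ r := by
          intro r hr
          rw [hψ₀]
          simp only
          rw [← mul_assoc, ← ENNReal.ofReal_mul hv.le]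
          refine le_mul_of_one_le_left (zero_le) (ENNReal.one_le_ofReal.2 ?_)
          calc 1 = v * v⁻¹ := (mul_inv_cancel₀ hv.ne').symm
            _ ≤ v * |h' r| := mul_le_mul_of_nonneg_left (alt r hr) hv.le
        refine (enorm_sub_sq_le _ _).trans (le_trans ?_ le_add_self)
        rw [mul_assoc, mul_assoc]
        refine add_le_add ?_ (le_trans ?_ le_self_add)
        · gcongr
          exact big _ ⟨by linarith, le_rfl⟩
        · gcongr
          exact big _ ⟨le_rfl, by linarith⟩
  have hcard : (Z.card : ℝ≥0∞) ≤ 2 * m := by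
    have : Z.card ≤ 2 * m := (Finset.card_union_le _ _).trans (by omega)
    exact_mod_cast this
  have ibad : ∫⁻ s in Icc α (β - v), bad s ≤ ENNReal.ofReal v * (8 * (m * B)) := by
    calc ∫⁻ s in Icc α (β - v), bad s ≤ ∫⁻ s, bad s := setLIntegral_le_lintegral _ _
      _ = Z.card * (4 * B * ENNReal.ofReal v) := by
        rw [hbad, lintegral_finsetSum _ fun z _ => measurable_const.indicator measurableSet_Icc]
        simp [lintegral_indicator measurableSet_Icc]
      _ ≤ 2 * m * (4 * B * ENNReal.ofReal v) := by gcongr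
      _ = _ := by ring
  calc ∫⁻ s in Icc α (β - v), ‖G (h (s + v)) - G (h s)‖ₑ ^ 2
      ≤ ∫⁻ s in Icc α (β - v), (bad s + (2 * ENNReal.ofReal v * ψ₀ (s + v) +
        (2 * ENNReal.ofReal v * ψ₀ s + ∫⁻ r in Ioc 0 v, ψ₁ (s + r)))) :=
        setLIntegral_mono' measurableSet_Icc pt
    _ = (∫⁻ s in Icc α (β - v), bad s) + (2 * ENNReal.ofReal v *
        (∫⁻ s in Icc α (β - v), ψ₀ (s + v)) + (2 * ENNReal.ofReal v *
        (∫⁻ s in Icc α (β - v), ψ₀ s) + ∫⁻ s in Icc α (β - v), ∫⁻ r in Ioc 0 v, ψ₁ (s + r))) := by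
        have mm : Measurable fun s => ψ₀ (s + v) := m₀.comp (measurable_add_const v)
        rw [lintegral_add_left mbad, lintegral_add_left (mm.const_mul _),
          lintegral_add_left (m₀.const_mul _), lintegral_const_mul _ mm, lintegral_const_mul _ m₀]
    -- The constant is `13 = 8 + 2 + 2 + 1`: at most `2 * m` crossings of weight `4 * B`, the two
    -- large-derivative terms, and the small-derivative term.
    _ ≤ ENNReal.ofReal v * (8 * (m * B)) + (2 * ENNReal.ofReal v * (m * B) +
        (2 * ENNReal.ofReal v * (m * B) + ENNReal.ofReal v * (m * B))) := by
        refine add_le_add ibad (add_le_add (mul_le_mul_right ?_ _)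
          (add_le_add (mul_le_mul_right ?_ _) ?_))
        · exact (setLIntegral_shift_le m₀ hv.le le_rfl).trans h0
        · exact (lintegral_mono_set (Icc_subset_Icc_right (by linarith))).trans h0
        · exact (setLIntegral_setLIntegral_shift_le m₁).trans (mul_le_mul_right h1 _)
    _ = _ := by ring

end Composition

end Nikodym

namespace Nikodym

/-! ### Gagliardo energies from bounds on increments. -/

section Energy

theorem ofReal_mul_le_mul_mul {a b c : ℝ} (hb : 0 ≤ b) (h : a ≤ b * c) (M : ℝ≥0∞) :
    ENNReal.ofReal a * M ≤ ENNReal.ofReal b * (ENNReal.ofReal c * M) := by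
  rw [← mul_assoc, ← ENNReal.ofReal_mul hb]
  gcongr

/-- The integrand is symmetric, so the part `u < r` is counted twice; there substitute `r = u + v`
and integrate first along lines of constant difference. -/
theorem gagliardo_le {f : ℝ → ℂ} (hf : Continuous f) (α β ε : ℝ) :
    gagliardo α β ε f ≤ 2 * ∫⁻ v in Ioc 0 (β - α), ENNReal.ofReal (((v + ε) ^ 2)⁻¹) *
      ∫⁻ s in Icc α (β - v), ‖f (s + v) - f s‖ₑ ^ 2 := by
  set K : ℝ × ℝ → ℝ≥0∞ := fun p =>
    ENNReal.ofReal (((|p.1 - p.2| + ε) ^ 2)⁻¹) * ‖f p.1 - f p.2‖ₑ ^ 2 with hK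
  have mK : Measurable K := measurable_gagliardo_integrand ε hf
  set S : Set (ℝ × ℝ) := {p | p.2 < p.1 ∧ p.1 ≤ β ∧ α ≤ p.2} with hS
  have mS : MeasurableSet S := by
    refine (measurableSet_lt measurable_snd measurable_fst).inter
      ((measurableSet_le measurable_fst measurable_const).inter
        (measurableSet_le measurable_const measurable_snd))
  set Φ : ℝ × ℝ → ℝ≥0∞ := S.indicator K with hΦ
  have mΦ : Measurable Φ := mK.indicator mS
  have symK : ∀ r u, K (r, u) = K (u, r) := by
    intro r u
    simp only [hK]
    rw [abs_sub_comm, ← enorm_neg (f r - f u), neg_sub]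
  have step1 : gagliardo α β ε f ≤ ∫⁻ r, ∫⁻ u, (Φ (r, u) + Φ (u, r)) := by
    unfold gagliardo
    rw [← lintegral_indicator measurableSet_Icc]
    refine lintegral_mono fun r => ?_
    refine indicator_apply_le' (fun hr => ?_) (fun _ => zero_le)
    rw [← lintegral_indicator measurableSet_Icc]
    refine lintegral_mono fun u => ?_
    refine indicator_apply_le' (fun hu => ?_) (fun _ => zero_le)
    rcases lt_trichotomy u r with h | h | h
    · refine le_trans (le_of_eq ?_) le_self_add
      rw [hΦ, indicator_of_mem (show (r, u) ∈ S from ⟨h, hr.2, hu.1⟩)]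
    · simp [h]
    · refine le_trans (le_of_eq ?_) le_add_self
      rw [hΦ, indicator_of_mem (show (u, r) ∈ S from ⟨h, hu.2, hr.1⟩), ← symK]
  have step2 : ∫⁻ r, ∫⁻ u, (Φ (r, u) + Φ (u, r)) = 2 * ∫⁻ u, ∫⁻ r, Φ (r, u) := by
    have m1 : ∀ r, Measurable fun u => Φ (r, u) := fun r => mΦ.comp measurable_prodMk_left
    have m2 : Measurable fun r => ∫⁻ u, Φ (r, u) := mΦ.lintegral_prod_right'
    simp_rw [lintegral_add_left (m1 _)]
    rw [lintegral_add_left m2, two_mul]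
    congr 1
    exact lintegral_lintegral_swap (f := fun r u => Φ (r, u)) mΦ.aemeasurable
  have step3 : ∫⁻ u, ∫⁻ r, Φ (r, u) = ∫⁻ v, ∫⁻ u, Φ (u + v, u) := by
    have : ∀ u, ∫⁻ r, Φ (r, u) = ∫⁻ v, Φ (u + v, u) := fun u =>
      (lintegral_add_left_eq_self (fun r => Φ (r, u)) u).symm
    simp_rw [this]
    refine lintegral_lintegral_swap (f := fun u v => Φ (u + v, u)) (Measurable.aemeasurable ?_)
    exact mΦ.comp ((measurable_fst.add measurable_snd).prodMk measurable_fst)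
  have step4 : ∫⁻ v, ∫⁻ u, Φ (u + v, u) ≤ ∫⁻ v in Ioc 0 (β - α),
      ENNReal.ofReal (((v + ε) ^ 2)⁻¹) * ∫⁻ s in Icc α (β - v), ‖f (s + v) - f s‖ₑ ^ 2 := by
    rw [← lintegral_indicator measurableSet_Ioc]
    refine lintegral_mono fun v => ?_
    by_cases hv : v ∈ Ioc 0 (β - α)
    · rw [indicator_of_mem hv, ← lintegral_const_mul' _ _ ENNReal.ofReal_ne_top,
        ← lintegral_indicator measurableSet_Icc]
      refine lintegral_mono fun u => ?_
      by_cases hu : (u + v, u) ∈ S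
      · rw [hΦ, indicator_of_mem hu, indicator_of_mem
          (show u ∈ Icc α (β - v) from ⟨hu.2.2, by linarith [hu.2.1]⟩)]
        simp only [hK]
        rw [add_sub_cancel_left, abs_of_pos hv.1]
      · rw [hΦ, indicator_of_notMem hu]
        exact zero_le
    · rw [indicator_of_notMem hv]
      refine (lintegral_eq_zero_of_ae_eq_zero (Filter.Eventually.of_forall fun u => ?_)).le
      refine indicator_of_notMem (fun hu => hv ⟨?_, ?_⟩) _
      · have := hu.1
        simp only at this
        linarith
      · have h1 := hu.2.1
        have h2 := hu.2.2
        simp only at h1 h2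
        linarith
  calc gagliardo α β ε f ≤ _ := step1
    _ = _ := step2
    _ ≤ _ := by
      rw [step3]
      exact mul_le_mul_right step4 _

/-- Linear growth of the increments turns the kernel into `v / (v + ε)² ≤ 1 / (v + ε)`; the
regularisation `ε` keeps the resulting logarithm finite. -/
theorem gagliardo_le_log {f : ℝ → ℂ} (hf : Continuous f) {α β ε : ℝ} (hαβ : α ≤ β) (hε : 0 < ε)
    {M : ℝ≥0∞} (hM : ∀ v ∈ Ioc 0 (β - α),
      ∫⁻ s in Icc α (β - v), ‖f (s + v) - f s‖ₑ ^ 2 ≤ ENNReal.ofReal v * M) :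
    gagliardo α β ε f ≤ 2 * (ENNReal.ofReal (Real.log ((β - α + ε) / ε)) * M) := by
  refine (gagliardo_le hf α β ε).trans (mul_le_mul_right ?_ _)
  have hL : 0 ≤ β - α := by linarith
  have hcont : ContinuousOn (fun v : ℝ => (v + ε)⁻¹) (Icc 0 (β - α)) :=
    (continuousOn_id.add continuousOn_const).inv₀ fun v hv => by
      exact (add_pos_of_nonneg_of_pos hv.1 hε).ne'
  have hint : ENNReal.ofReal (Real.log ((β - α + ε) / ε)) =
      ∫⁻ v in Ioc 0 (β - α), ENNReal.ofReal ((v + ε)⁻¹) := by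
    have e : ∫ v in (0 : ℝ)..(β - α), (v + ε)⁻¹ = Real.log ((β - α + ε) / ε) := by
      rw [intervalIntegral.integral_comp_add_right (fun v => v⁻¹) ε, zero_add,
        integral_inv_of_pos hε (by linarith)]
    rw [← e, intervalIntegral.integral_of_le hL, ofReal_integral_eq_lintegral_ofReal]
    · exact hcont.integrableOn_Icc.mono_set Ioc_subset_Icc_self
    · refine (ae_restrict_iff' measurableSet_Ioc).2 (Filter.Eventually.of_forall fun v hv => ?_)
      have := hv.1
      simp only [Pi.zero_apply]
      positivity
  have mm : Measurable fun v : ℝ => ENNReal.ofReal ((v + ε)⁻¹) := by fun_prop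
  rw [hint, ← lintegral_mul_const _ mm]
  refine setLIntegral_mono' measurableSet_Ioc fun v hv => ?_
  have hv0 := hv.1
  refine (mul_le_mul_right (hM v hv) _).trans ?_
  rw [← mul_assoc, ← ENNReal.ofReal_mul (by positivity)]
  gcongr
  rw [inv_mul_eq_div, div_le_iff₀ (by positivity), sq, ← mul_assoc,
    inv_mul_cancel₀ (by positivity)]
  linarith

theorem lintegral_rescaled_inv_one_add_sq {R : ℝ} (hR : 0 < R) :
    ∫⁻ v : ℝ, ENNReal.ofReal (R * (1 + (R * v) ^ 2)⁻¹) = ENNReal.ofReal Real.pi := by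
  rw [← ofReal_integral_eq_lintegral_ofReal]
  · rw [integral_const_mul, Measure.integral_comp_mul_left (fun v => (1 + v ^ 2)⁻¹) R,
      integral_univ_inv_one_add_sq, abs_of_pos (inv_pos.2 hR), smul_eq_mul, ← mul_assoc,
      mul_inv_cancel₀ hR.ne', one_mul]
  · exact (integrable_inv_one_add_sq.comp_mul_left' hR.ne').const_mul R
  · exact Filter.Eventually.of_forall fun v => by positivity

/-- Against the kernel `v⁻²` the two bounds give `min R (1 / (R v²)) ≤ 2 R / (1 + (R v)²)`, whose
integral does not depend on `R`. This scale invariance makes the estimate uniform in the frequency.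
-/
theorem gagliardo_le_const {f : ℝ → ℂ} (hf : Continuous f) {α β ε R : ℝ} (hε : 0 < ε)
    (hR : 0 < R) {M : ℝ≥0∞}
    (h1 : ∀ v ∈ Ioc 0 (β - α),
      ∫⁻ s in Icc α (β - v), ‖f (s + v) - f s‖ₑ ^ 2 ≤ ENNReal.ofReal (v ^ 2 * R) * M)
    (h2 : ∀ v ∈ Ioc 0 (β - α),
      ∫⁻ s in Icc α (β - v), ‖f (s + v) - f s‖ₑ ^ 2 ≤ ENNReal.ofReal R⁻¹ * M) :
    gagliardo α β ε f ≤ 4 * (ENNReal.ofReal Real.pi * M) := by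
  have mm : Measurable fun v : ℝ => ENNReal.ofReal (R * (1 + (R * v) ^ 2)⁻¹) := by fun_prop
  have key : ∫⁻ v in Ioc 0 (β - α), ENNReal.ofReal (((v + ε) ^ 2)⁻¹) *
      ∫⁻ s in Icc α (β - v), ‖f (s + v) - f s‖ₑ ^ 2 ≤ 2 * (ENNReal.ofReal Real.pi * M) := by
    rw [← lintegral_rescaled_inv_one_add_sq hR, ← lintegral_mul_const _ mm,
      ← lintegral_const_mul _ (mm.mul_const M)]
    refine le_trans ?_ (setLIntegral_le_lintegral (Ioc 0 (β - α)) _)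
    refine setLIntegral_mono' measurableSet_Ioc fun v hv => ?_
    have hv0 := hv.1
    have hI : ∫⁻ s in Icc α (β - v), ‖f (s + v) - f s‖ₑ ^ 2 ≤
        ENNReal.ofReal (v ^ 2 * (2 * (R * (1 + (R * v) ^ 2)⁻¹))) * M := by
      rcases le_total (R * v) 1 with h | h
      · refine (h1 v hv).trans ?_
        gcongr
        have : (R * v) ^ 2 ≤ 1 := pow_le_one₀ (by positivity) h
        rw [← mul_assoc, mul_comm 2 R, mul_assoc]
        refine le_mul_of_one_le_right hR.le ?_
        rw [← div_eq_mul_inv, le_div_iff₀ (by positivity)]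
        linarith
      · refine (h2 v hv).trans ?_
        gcongr
        have h' : 1 ≤ (R * v) ^ 2 := one_le_pow₀ h
        rw [show v ^ 2 * (2 * (R * (1 + (R * v) ^ 2)⁻¹)) =
          R⁻¹ * (2 * (R * v) ^ 2 / (1 + (R * v) ^ 2)) by field_simp]
        refine le_mul_of_one_le_right (by positivity) ?_
        rw [le_div_iff₀ (by positivity)]
        linarith
    refine (mul_le_mul_right hI _).trans ?_
    rw [← mul_assoc, ← ENNReal.ofReal_mul (by positivity), ← ENNReal.ofReal_ofNat]
    refine ofReal_mul_le_mul_mul (by norm_num) ?_ M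
    rw [← mul_assoc]
    refine mul_le_of_le_one_left (by positivity) ?_
    rw [inv_mul_eq_div, div_le_one (by positivity)]
    gcongr
    linarith
  refine (gagliardo_le hf α β ε).trans ((mul_le_mul_right key _).trans_eq ?_)
  rw [← mul_assoc]
  norm_num

theorem gagliardo_const (α β ε : ℝ) (z : ℂ) : gagliardo α β ε (fun _ => z) = 0 := by
  simp [gagliardo]

theorem gagliardo_const_mul (α β ε : ℝ) (z : ℂ) (f : ℝ → ℂ) :
    gagliardo α β ε (fun s => z * f s) = ‖z‖ₑ ^ 2 * gagliardo α β ε f := by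
  have hz : ‖z‖ₑ ^ 2 ≠ ⊤ := by simp
  unfold gagliardo
  rw [← lintegral_const_mul' _ _ hz]
  simp_rw [← lintegral_const_mul' _ _ hz, ← mul_sub, enorm_mul, mul_pow, mul_left_comm (‖z‖ₑ ^ 2)]

variable {H : ℕ → ℝ → ℝ} {G G' : ℝ → ℂ} {α β ε : ℝ} {B : ℝ≥0∞}

/-- The energy of `G ∘ h` when `h'` is comparable to a constant. -/
theorem gagliardo_comp_le_of_deriv (hαβ : α ≤ β) (hε : 0 < ε) (hc : ∀ j, Continuous (H j))
    (hd : ∀ j, ∀ s ∈ Ioo α β, HasDerivAt (H j) (H (j + 1) s) s)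
    (hG : ∀ u, HasDerivAt G (G' u) u) (hG' : Continuous G') (hB : B ≠ ⊤)
    (hGB : ∫⁻ u, ‖G u‖ₑ ^ 2 ≤ B) (hG'B : ∫⁻ u, ‖G' u‖ₑ ^ 2 ≤ B)
    {R c T : ℝ} (hR : 0 < R) (hc0 : 0 < c) (hlow : ∀ s ∈ Icc α β, c * R ≤ |H 1 s|)
    (hup : ∀ s ∈ Icc α β, |H 1 s| ≤ T * R) (hT : 0 ≤ T) :
    gagliardo α β ε (fun s => G (H 0 s)) ≤
      4 * (ENNReal.ofReal Real.pi * (ENNReal.ofReal (T + 4 / c) * B)) := by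
  have hGc : Continuous G := continuous_iff_continuousAt.2 fun u => (hG u).continuousAt
  -- No critical points, hence a single monotone piece and `n = 1` in the change of variables.
  have hne : ∀ s ∈ Ioo α β, H 1 s = 0 → s ∈ (∅ : Finset ℝ) := fun s hs h0 => by
    have := hlow s (Ioo_subset_Icc_self hs)
    rw [h0, abs_zero] at this
    exact absurd this (not_le.2 (by positivity))
  have i0 := setLIntegral_abs_deriv_mul_comp_le (hc 0) (hc 1) hαβ (hd 0) hne hGc (n := 1)
    (by simp) hB hGB
  have i1 := setLIntegral_abs_deriv_mul_comp_le (hc 0) (hc 1) hαβ (hd 0) hne hG' (n := 1)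
    (by simp) hB hG'B
  rw [Nat.cast_one, one_mul] at i0 i1
  have hcont : Continuous fun s => G (H 0 s) := hGc.comp (hc 0)
  refine gagliardo_le_const hcont hε hR (fun v hv => ?_) fun v hv => ?_
  · have := setLIntegral_increment_le_of_abs_deriv_le (hc 0) (hc 1) (hd 0) hG hG' hv.1.le
      (T := T * R) (by positivity) hup
    refine this.trans ((mul_le_mul_right i1 _).trans ?_)
    refine ofReal_mul_le_mul_mul (by positivity) ?_ B
    rw [mul_comm T R, ← mul_assoc]
    gcongr
    have : 0 ≤ 4 / c := by positivity
    linarith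
  · refine (setLIntegral_increment_le_two_mul (hc 0) hGc hv.1.le).trans ?_
    have h3 : ∫⁻ s in Icc α β, ‖G (H 0 s)‖ₑ ^ 2 ≤ ENNReal.ofReal (c * R)⁻¹ * B := by
      refine le_trans ?_ (mul_le_mul_right i0 _)
      rw [← lintegral_const_mul' _ _ ENNReal.ofReal_ne_top]
      refine setLIntegral_mono' measurableSet_Icc fun s hs => ?_
      rw [← mul_assoc, ← ENNReal.ofReal_mul (by positivity)]
      refine le_mul_of_one_le_left zero_le (ENNReal.one_le_ofReal.2 ?_)
      rw [inv_mul_eq_div, one_le_div (by positivity)]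
      exact hlow s hs
    refine (mul_le_mul_right h3 _).trans ?_
    rw [← mul_assoc, ← ENNReal.ofReal_ofNat, ← ENNReal.ofReal_mul (by norm_num)]
    refine ofReal_mul_le_mul_mul (by positivity) ?_ B
    rw [mul_inv, ← mul_assoc, mul_comm R⁻¹]
    gcongr
    rw [← div_eq_mul_inv]
    linarith

/-- The energy of `G ∘ h` when some derivative of `h` of order at least two does not vanish. -/
theorem gagliardo_comp_le_of_iterated_deriv (hαβ : α ≤ β) (hε : 0 < ε) (hc : ∀ j, Continuous (H j))
    (hd : ∀ j, ∀ s ∈ Ioo α β, HasDerivAt (H j) (H (j + 1) s) s)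
    (hG : ∀ u, HasDerivAt G (G' u) u) (hG' : Continuous G') (hB : B ≠ ⊤)
    (hGB : ∫⁻ u, ‖G u‖ₑ ^ 2 ≤ B) (hG'B : ∫⁻ u, ‖G' u‖ₑ ^ 2 ≤ B) (hGs : ∀ u, ‖G u‖ₑ ^ 2 ≤ B)
    {k : ℕ} (hk : ∀ s ∈ Ioo α β, H (k + 2) s ≠ 0) :
    gagliardo α β ε (fun s => G (H 0 s)) ≤
      2 * (ENNReal.ofReal (Real.log ((β - α + ε) / ε)) * (13 * ((k + 2 : ℕ) * B))) := by
  have hGc : Continuous G := continuous_iff_continuousAt.2 fun u => (hG u).continuousAt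
  have hcross : ∀ c : ℝ, ∃ Z : Finset ℝ, Z.card ≤ k + 1 ∧ ∀ s ∈ Ioo α β, H 1 s = c → s ∈ Z := by
    intro c
    obtain ⟨Z, hZ, hz⟩ := exists_finset_zeros (α := α) (β := β) (k + 1)
      -- The constant `c` disappears after one differentiation, so only the zeroth entry of the
      -- chain starting at `h'` is altered.
      (fun j => if j = 0 then fun s => H 1 s - c else H (j + 1))
      (fun j => by
        rcases j with _ | j
        · exact (hc 1).sub continuous_const
        · simpa using hc _)
      (fun j s hs => by
        rcases j with _ | j
        · simpa using (hd 1 s hs).sub_const c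
        · simpa using hd _ s hs)
      (by simpa using hk)
    exact ⟨Z, hZ, fun s hs h => hz s hs (by simp [h])⟩
  obtain ⟨Z, hZ, hz⟩ := hcross 0
  -- At most `k + 1` critical points cut the interval into at most `k + 2` monotone pieces.
  have i0 := setLIntegral_abs_deriv_mul_comp_le (hc 0) (hc 1) hαβ (hd 0) hz hGc (n := k + 2)
    (by omega) hB hGB
  have i1 := setLIntegral_abs_deriv_mul_comp_le (hc 0) (hc 1) hαβ (hd 0) hz hG' (n := k + 2)
    (by omega) hB hG'B
  refine gagliardo_le_log (hGc.comp (hc 0)) hαβ hε fun v hv => ?_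
  refine setLIntegral_increment_le_mul (hc 0) (hc 1) (hd 0) hG hG' hv.1 hGs i0 i1 fun c => ?_
  obtain ⟨Z, hZ, hz⟩ := hcross c
  exact ⟨Z, by omega, hz⟩

end Energy

end Nikodym

namespace Nikodym

/-! ### Band-limited functions and the partial Fourier transform. -/

section FourierSide

open FourierTransform Real
open scoped InnerProductSpace

/-- As `|t| ≤ 1` on the support, the function `-2πit f` whose transform is the derivative has size
at most `2π |f|`, and the supremum follows from Cauchy–Schwarz on an interval of length `2`. The
constant `40 ≥ (2π)²` serves all three bounds. -/
theorem fourier_band_limited {f : ℝ → ℂ} (hf : Integrable f) (hf2 : MemLp f 2)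
    (hs : ∀ t, t ∉ I → f t = 0) :
    ∃ G' : ℝ → ℂ, (∀ u, HasDerivAt (𝓕 f) (G' u) u) ∧ Continuous G' ∧
      (∫⁻ u, ‖𝓕 f u‖ₑ ^ 2 ≤ 40 * ∫⁻ t, ‖f t‖ₑ ^ 2) ∧
      (∫⁻ u, ‖G' u‖ₑ ^ 2 ≤ 40 * ∫⁻ t, ‖f t‖ₑ ^ 2) ∧
      ∀ u, ‖𝓕 f u‖ₑ ^ 2 ≤ 40 * ∫⁻ t, ‖f t‖ₑ ^ 2 := by
  have hmul : ∀ t : ℝ, ‖(-2 * π * Complex.I * t) • f t‖ ≤ 2 * π * ‖f t‖ := by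
    intro t
    by_cases ht : t ∈ I
    · have : |t| ≤ 1 := abs_le.2 ht
      simp only [norm_smul, norm_mul, norm_neg, Complex.norm_ofNat, Complex.norm_I, mul_one,
        Complex.norm_real, Real.norm_eq_abs, abs_of_pos pi_pos]
      exact mul_le_mul_of_nonneg_right (mul_le_of_le_one_right (by positivity) this)
        (norm_nonneg _)
    · simp [hs t ht]
  have hmeas : AEStronglyMeasurable (fun t : ℝ => (-2 * π * Complex.I * t : ℂ) • f t) volume :=
    (Continuous.aestronglyMeasurable (f := fun t : ℝ => (-2 * π * Complex.I * t : ℂ))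
      (by fun_prop)).smul hf.aestronglyMeasurable
  have hi' : Integrable fun t : ℝ => (-2 * π * Complex.I * t : ℂ) • f t :=
    (hf.norm.const_mul (2 * π)).mono' hmeas (Filter.Eventually.of_forall hmul)
  have hi'' : Integrable fun t : ℝ => t • f t := by
    refine hf.mono (continuous_id.aestronglyMeasurable.smul hf.aestronglyMeasurable)
      (Filter.Eventually.of_forall fun t => ?_)
    by_cases ht : t ∈ I
    · rw [norm_smul, Real.norm_eq_abs]
      exact mul_le_of_le_one_left (norm_nonneg _) (abs_le.2 ht)
    · simp [hs t ht]
  have h2' : MemLp (fun t : ℝ => (-2 * π * Complex.I * t : ℂ) • f t) 2 :=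
    (hf2.norm.const_mul (2 * π)).of_le hmeas (Filter.Eventually.of_forall fun t => by
      refine (hmul t).trans (le_of_eq ?_)
      rw [Real.norm_of_nonneg (by positivity)])
  have hpi : (2 * π) ^ 2 ≤ 40 := by nlinarith [pi_pos, pi_lt_d2]
  refine ⟨_, fun u => Real.hasDerivAt_fourier hf hi'' u, continuous_fourier hi', ?_, ?_, ?_⟩
  · rw [lintegral_enorm_fourier_sq hf hf2]
    exact le_mul_of_one_le_left zero_le (by norm_num)
  · rw [lintegral_enorm_fourier_sq hi' h2', ← lintegral_const_mul' _ _ (by norm_num)]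
    refine lintegral_mono fun t => ?_
    simp only
    rw [← ofReal_norm_sq, ← ofReal_norm_sq, ← ENNReal.ofReal_ofNat,
      ← ENNReal.ofReal_mul (by norm_num)]
    apply ENNReal.ofReal_le_ofReal
    calc ‖(-2 * π * Complex.I * t) • f t‖ ^ 2 ≤ (2 * π * ‖f t‖) ^ 2 := by
          gcongr
          exact hmul t
      _ = (2 * π) ^ 2 * ‖f t‖ ^ 2 := by ring
      _ ≤ 40 * ‖f t‖ ^ 2 := by gcongr
  · intro u
    have h1 : ‖𝓕 f u‖ₑ ≤ ∫⁻ t in I, ‖f t‖ₑ := by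
      rw [Real.fourier_eq]
      refine (enorm_integral_le_lintegral_enorm _).trans ?_
      rw [← lintegral_indicator (show MeasurableSet I from measurableSet_Icc)]
      refine lintegral_mono fun t => ?_
      have e : ‖𝐞 (-⟪t, u⟫_ℝ) • f t‖ₑ = ‖f t‖ₑ := by
        rw [← ofReal_norm, Circle.norm_smul, ofReal_norm]
      simp only [e]
      by_cases ht : t ∈ I
      · rw [indicator_of_mem ht]
      · simp [hs t ht]
    have h2 : (∫⁻ t in I, ‖f t‖ₑ) ^ 2 ≤ 2 * ∫⁻ t, ‖f t‖ₑ ^ 2 := by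
      have := ENNReal.lintegral_mul_le_Lp_mul_Lq (volume.restrict I) Real.HolderConjugate.two_two
        (f := fun t => ‖f t‖ₑ) (g := fun _ => 1) hf2.1.enorm.restrict aemeasurable_const
      simp only [Pi.mul_apply, mul_one, ENNReal.rpow_ofNat, one_pow, lintegral_const, one_mul,
        Measure.restrict_apply_univ] at this
      have hvol : volume I = 2 := by
        rw [I, Real.volume_Icc]
        norm_num
      rw [hvol] at this
      calc (∫⁻ t in I, ‖f t‖ₑ) ^ 2
          ≤ ((∫⁻ t in I, ‖f t‖ₑ ^ 2) ^ (1 / 2 : ℝ) * 2 ^ (1 / 2 : ℝ)) ^ 2 := by gcongr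
        _ = (∫⁻ t in I, ‖f t‖ₑ ^ 2) * 2 := by
          rw [mul_pow, ← ENNReal.rpow_natCast, ← ENNReal.rpow_natCast, ← ENNReal.rpow_mul,
            ← ENNReal.rpow_mul]
          norm_num
        _ ≤ 2 * ∫⁻ t, ‖f t‖ₑ ^ 2 := by
          rw [mul_comm]
          exact mul_le_mul_right (setLIntegral_le_lintegral _ _) _
    calc ‖𝓕 f u‖ₑ ^ 2 ≤ (∫⁻ t in I, ‖f t‖ₑ) ^ 2 := by gcongr
      _ ≤ _ := h2
      _ ≤ _ := by
        gcongr
        norm_num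

variable {V : Type*} [NormedAddCommGroup V] [InnerProductSpace ℝ V] [FiniteDimensional ℝ V]
  [MeasurableSpace V] [BorelSpace V]

/-- The Fourier transform of `g` in both variables, at `(ξ, u)`. -/
noncomputable def fullFourier (g : V × ℝ → ℂ) (ξ : V) (u : ℝ) : ℂ :=
  ∫ p : V × ℝ, (𝐞 (-(⟪p.1, ξ⟫_ℝ + p.2 * u)) : ℂ) * g p

theorem norm_fourierChar (a : ℝ) : ‖(𝐞 a : ℂ)‖ = 1 := Circle.norm_coe _

theorem continuous_fullFourier {g : V × ℝ → ℂ} (hg : Integrable g) :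
    Continuous fun q : V × ℝ => fullFourier g q.1 q.2 := by
  refine continuous_of_dominated (bound := fun p => ‖g p‖) (fun q => ?_) (fun q => ?_) hg.norm ?_
  · refine AEStronglyMeasurable.mul (Continuous.aestronglyMeasurable ?_) hg.1
    exact continuous_subtype_val.comp (Real.continuous_fourierChar.comp (by fun_prop))
  · exact Filter.Eventually.of_forall fun p => by rw [norm_mul, norm_fourierChar, one_mul]
  · refine Filter.Eventually.of_forall fun p => Continuous.mul ?_ continuous_const
    exact continuous_subtype_val.comp (Real.continuous_fourierChar.comp (by fun_prop))

theorem norm_fullFourier_le (g : V × ℝ → ℂ) (ξ : V) (u : ℝ) :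
    ‖fullFourier g ξ u‖ ≤ ∫ p, ‖g p‖ := by
  refine (norm_integral_le_integral_norm _).trans (le_of_eq ?_)
  simp_rw [norm_mul, norm_fourierChar, one_mul]

/-- The Fourier transform of `g` in the space variable. -/
noncomputable def partialFourier (g : V × ℝ → ℂ) (ξ : V) (t : ℝ) : ℂ := 𝓕 (fun y => g (y, t)) ξ

theorem integrable_char_mul {g : V × ℝ → ℂ} (hg : Integrable g) (ξ : V) (u : ℝ) :
    Integrable fun p : V × ℝ => (𝐞 (-(⟪p.1, ξ⟫_ℝ + p.2 * u)) : ℂ) * g p := by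
  refine hg.norm.mono' (AEStronglyMeasurable.mul (Continuous.aestronglyMeasurable ?_) hg.1)
    (Filter.Eventually.of_forall fun p => ?_)
  · exact continuous_subtype_val.comp (Real.continuous_fourierChar.comp (by fun_prop))
  · rw [norm_mul, norm_fourierChar, one_mul]

theorem fullFourier_eq_fourier_partialFourier {g : V × ℝ → ℂ} (hg : Integrable g) (ξ : V) (u : ℝ) :
    fullFourier g ξ u = 𝓕 (partialFourier g ξ) u := by
  unfold fullFourier
  rw [Measure.volume_eq_prod, integral_prod_symm _ (integrable_char_mul hg ξ u), Real.fourier_eq]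
  refine integral_congr_ae (Filter.Eventually.of_forall fun t => ?_)
  simp only [partialFourier, Real.fourier_eq, Circle.smul_def, smul_eq_mul]
  rw [← integral_const_mul]
  refine integral_congr_ae (Filter.Eventually.of_forall fun y => ?_)
  simp only
  rw [← mul_assoc, ← Circle.coe_mul, ← AddChar.map_add_eq_mul, neg_add, add_comm]
  simp [mul_comm]

theorem stronglyMeasurable_partialFourier {g : V × ℝ → ℂ} (hm : StronglyMeasurable g) :
    StronglyMeasurable fun q : V × ℝ => partialFourier g q.1 q.2 := by
  simp only [partialFourier, Real.fourier_eq, Circle.smul_def, smul_eq_mul]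
  refine StronglyMeasurable.integral_prod_right'
    (f := fun q : (V × ℝ) × V => (𝐞 (-⟪q.2, q.1.1⟫_ℝ) : ℂ) * g (q.2, q.1.2)) ?_
  refine StronglyMeasurable.mul (Continuous.stronglyMeasurable ?_) (hm.comp_measurable ?_)
  · exact continuous_subtype_val.comp (Real.continuous_fourierChar.comp (by fun_prop))
  · fun_prop

theorem integrable_partialFourier {g : V × ℝ → ℂ} (hm : StronglyMeasurable g) (hg : Integrable g)
    (ξ : V) : Integrable (partialFourier g ξ) := by
  rw [Measure.volume_eq_prod] at hg
  refine hg.integral_norm_prod_right.mono'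
    ((stronglyMeasurable_partialFourier hm).comp_measurable
      measurable_prodMk_left).aestronglyMeasurable (Filter.Eventually.of_forall fun t => ?_)
  rw [partialFourier, Real.fourier_eq]
  refine (norm_integral_le_integral_norm _).trans (le_of_eq ?_)
  simp_rw [Circle.norm_smul]

/-- Tonelli, then Plancherel in `y` on almost every slice, where `g (·, t)` lies in `L¹ ∩ L²`. -/
theorem lintegral_partialFourier_sq {g : V × ℝ → ℂ} (hm : StronglyMeasurable g)
    (hg : Integrable g) (hg2 : ∫⁻ p, ‖g p‖ₑ ^ 2 ≠ ⊤) :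
    ∫⁻ ξ, ∫⁻ t, ‖partialFourier g ξ t‖ₑ ^ 2 = ∫⁻ p, ‖g p‖ₑ ^ 2 := by
  have mg : Measurable fun p => ‖g p‖ₑ ^ 2 := hm.enorm.pow_const 2
  rw [Measure.volume_eq_prod] at hg hg2 ⊢
  rw [lintegral_prod_symm _ mg.aemeasurable] at hg2 ⊢
  rw [lintegral_lintegral_swap (((stronglyMeasurable_partialFourier hm).enorm.pow_const
    2).aemeasurable)]
  refine lintegral_congr_ae ?_
  filter_upwards [hg.prod_left_ae, ae_lt_top (mg.lintegral_prod_left') hg2] with t h1 h2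
  refine lintegral_enorm_fourier_sq h1 ⟨h1.1, ?_⟩
  rw [lintegral_enorm_sq_eq_eLpNorm] at h2
  exact lt_top_iff_ne_top.2 fun h => by simp [h] at h2

end FourierSide

end Nikodym

namespace Nikodym

/-! ### Gaussian averages along lines and their Fourier transforms. -/

section Kernel

set_option linter.unusedSectionVars false

open FourierTransform Real
open scoped InnerProductSpace

variable {V : Type*} [NormedAddCommGroup V] [InnerProductSpace ℝ V] [FiniteDimensional ℝ V]
  [MeasurableSpace V] [BorelSpace V]

/-- The `L¹`-normalised Gaussian of width `δ`. -/
noncomputable def gauss (δ : ℝ) (w : V) : ℝ :=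
  (δ ^ Module.finrank ℝ V)⁻¹ * Real.exp (-π * ‖w‖ ^ 2 / δ ^ 2)

/-- The Fourier transform of `gauss δ`. -/
noncomputable def gaussHat (δ : ℝ) (ξ : V) : ℝ := Real.exp (-(π * δ ^ 2) * ‖ξ‖ ^ 2)

theorem continuous_gauss (δ : ℝ) : Continuous (gauss δ : V → ℝ) := by
  unfold gauss
  fun_prop

theorem continuous_gaussHat (δ : ℝ) : Continuous (gaussHat δ : V → ℝ) := by
  unfold gaussHat
  fun_prop

theorem gaussHat_le_one (δ : ℝ) (ξ : V) : gaussHat δ ξ ≤ 1 := by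
  rw [gaussHat, Real.exp_le_one_iff]
  nlinarith [mul_nonneg (mul_nonneg pi_pos.le (sq_nonneg δ)) (sq_nonneg ‖ξ‖)]

theorem gaussHat_pos (δ : ℝ) (ξ : V) : 0 < gaussHat δ ξ := Real.exp_pos _

theorem gauss_nonneg {δ : ℝ} (hδ : 0 < δ) (w : V) : 0 ≤ gauss δ w := by
  unfold gauss
  positivity

theorem gauss_le {δ : ℝ} (hδ : 0 < δ) (w : V) :
    gauss δ w ≤ (δ ^ Module.finrank ℝ V)⁻¹ := by
  refine mul_le_of_le_one_right (by positivity) (Real.exp_le_one_iff.2 ?_)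
  rw [neg_mul, neg_div]
  exact neg_nonpos.2 (by positivity)

theorem integrable_gaussHat {δ : ℝ} (hδ : 0 < δ) : Integrable (gaussHat δ : V → ℝ) := by
  have := GaussianFourier.integrable_cexp_neg_mul_sq_norm_add (V := V)
    (b := ((π * δ ^ 2 : ℝ) : ℂ)) (by rw [Complex.ofReal_re]; positivity) 0 0
  convert! this.re using 2 with ξ
  simp only [gaussHat, inner_zero_left, Complex.ofReal_zero, mul_zero, add_zero,
    RCLike.re_to_complex]
  rw [show -((π * δ ^ 2 : ℝ) : ℂ) * (‖ξ‖ : ℂ) ^ 2 = ((-(π * δ ^ 2) * ‖ξ‖ ^ 2 : ℝ) : ℂ) by push_cast; ring,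
    Complex.exp_ofReal_re]

theorem fourierInv_gaussHat {δ : ℝ} (hδ : 0 < δ) (w : V) :
    𝓕⁻ (fun ξ : V => (gaussHat δ ξ : ℂ)) w = gauss δ w := by
  have hb : 0 < (((π * δ ^ 2 : ℝ) : ℂ)).re := by
    rw [Complex.ofReal_re]
    positivity
  have e : (fun ξ : V => (gaussHat δ ξ : ℂ)) =
      fun ξ : V => Complex.exp (-((π * δ ^ 2 : ℝ) : ℂ) * ‖ξ‖ ^ 2) := by
    ext ξ
    simp [gaussHat]
  rw [Real.fourierInv_eq_fourier_neg, e, fourier_gaussian_innerProductSpace hb, norm_neg]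
  have e1 : ((π : ℂ) / ((π * δ ^ 2 : ℝ) : ℂ)) ^ (Module.finrank ℝ V / 2 : ℂ) =
      (((δ ^ Module.finrank ℝ V)⁻¹ : ℝ) : ℂ) := by
    have h1 : ((π : ℂ) / ((π * δ ^ 2 : ℝ) : ℂ)) = (((δ ^ 2)⁻¹ : ℝ) : ℂ) := by
      rw [← Complex.ofReal_div]
      congr 1
      field_simp
    have h2 : (Module.finrank ℝ V / 2 : ℂ) = ((Module.finrank ℝ V / 2 : ℝ) : ℂ) := by
      push_cast
      ring
    rw [h1, h2, ← Complex.ofReal_cpow (by positivity)]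
    congr 1
    rw [Real.inv_rpow (by positivity), ← Real.rpow_natCast δ 2, ← Real.rpow_mul hδ.le]
    congr 1
    rw [show ((2 : ℕ) : ℝ) * (Module.finrank ℝ V / 2) = (Module.finrank ℝ V : ℝ) by
      push_cast; ring, Real.rpow_natCast]
  rw [e1, gauss]
  push_cast
  congr 2
  field_simp

/-- The Gaussian average of `g` along the line in direction `c` through `x`. -/
noncomputable def gaussAvg (δ : ℝ) (g : V × ℝ → ℂ) (x c : V) : ℂ :=
  ∫ p : V × ℝ, (gauss δ (x - p.1 - p.2 • c) : ℂ) * g p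

/-- The Fourier transform of `x ↦ gaussAvg δ g x c`. -/
noncomputable def gaussAvgHat (δ : ℝ) (g : V × ℝ → ℂ) (c ξ : V) : ℂ :=
  gaussHat δ ξ * fullFourier g ξ ⟪c, ξ⟫_ℝ

theorem continuous_gaussAvg {δ : ℝ} (hδ : 0 < δ) {g : V × ℝ → ℂ} (hg : Integrable g) :
    Continuous fun q : V × V => gaussAvg δ g q.1 q.2 := by
  have hc : ∀ F : V → ℝ, Continuous F → Continuous fun w => (F w : ℂ) := fun F hF => by fun_prop
  refine continuous_of_dominated (bound := fun p => (δ ^ Module.finrank ℝ V)⁻¹ * ‖g p‖)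
    (fun q => ?_) (fun q => ?_) (hg.norm.const_mul _) ?_
  · refine AEStronglyMeasurable.mul (Continuous.aestronglyMeasurable ?_) hg.1
    exact (hc _ (continuous_gauss δ)).comp (by fun_prop)
  · refine Filter.Eventually.of_forall fun p => ?_
    rw [norm_mul, Complex.norm_real, Real.norm_of_nonneg (gauss_nonneg hδ _)]
    exact mul_le_mul_of_nonneg_right (gauss_le hδ _) (norm_nonneg _)
  · refine Filter.Eventually.of_forall fun p => Continuous.mul ?_ continuous_const
    exact (hc _ (continuous_gauss δ)).comp (by fun_prop)

theorem continuous_gaussAvgHat (δ : ℝ) {g : V × ℝ → ℂ} (hg : Integrable g) :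
    Continuous fun q : V × V => gaussAvgHat δ g q.1 q.2 := by
  have h1 : Continuous fun q : V × V => (gaussHat δ q.2 : ℂ) :=
    Complex.continuous_ofReal.comp ((continuous_gaussHat δ).comp continuous_snd)
  exact h1.mul ((continuous_fullFourier hg).comp (f := fun q : V × V => (q.2, ⟪q.1, q.2⟫_ℝ))
    (by fun_prop))

theorem norm_gaussAvgHat_le (δ : ℝ) (g : V × ℝ → ℂ) (c ξ : V) :
    ‖gaussAvgHat δ g c ξ‖ ≤ gaussHat δ ξ * ∫ p, ‖g p‖ := by
  rw [gaussAvgHat, norm_mul, Complex.norm_real, Real.norm_of_nonneg (gaussHat_pos δ ξ).le]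
  exact mul_le_mul_of_nonneg_left (norm_fullFourier_le _ _ _) (gaussHat_pos δ ξ).le

theorem integrable_gaussAvgHat {δ : ℝ} (hδ : 0 < δ) {g : V × ℝ → ℂ} (hg : Integrable g) (c : V) :
    Integrable (gaussAvgHat δ g c) :=
  ((integrable_gaussHat hδ).mul_const _).mono'
    ((continuous_gaussAvgHat δ hg).comp (by fun_prop : Continuous fun ξ : V => (c, ξ))).aestronglyMeasurable
    (Filter.Eventually.of_forall (norm_gaussAvgHat_le δ g c))

theorem memLp_two_gaussAvgHat {δ : ℝ} (hδ : 0 < δ) {g : V × ℝ → ℂ} (hg : Integrable g) (c : V) :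
    MemLp (gaussAvgHat δ g c) 2 := by
  have hi := integrable_gaussAvgHat hδ hg c
  rw [memLp_two_iff_integrable_sq_norm hi.1]
  refine (hi.norm.const_mul (∫ p, ‖g p‖)).mono' (hi.1.norm.pow 2)
    (Filter.Eventually.of_forall fun ξ => ?_)
  rw [Real.norm_of_nonneg (by positivity), sq]
  gcongr
  exact (norm_gaussAvgHat_le δ g c ξ).trans
    (mul_le_of_le_one_left (integral_nonneg fun _ => norm_nonneg _) (gaussHat_le_one δ ξ))

/-- Write the Gaussian as the inverse transform of `gaussHat` and exchange integrals. The integral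
over `p` is then the full transform of `g` at `(ξ, ⟪c, ξ⟫)`, so the direction `c` enters only
through `⟪c, ξ⟫`. -/
theorem gaussAvg_eq_fourierInv {δ : ℝ} (hδ : 0 < δ) {g : V × ℝ → ℂ} (hg : Integrable g) (x c : V) :
    gaussAvg δ g x c = 𝓕⁻ (gaussAvgHat δ g c) x := by
  have hint : Integrable (Function.uncurry fun (ξ : V) (p : V × ℝ) =>
      ((𝐞 ⟪ξ, x - p.1 - p.2 • c⟫_ℝ : ℂ) * gaussHat δ ξ) * g p) (volume.prod volume) := by
    have h1 : Integrable (fun q : V × (V × ℝ) => (gaussHat δ q.1 : ℂ) * g q.2)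
        (volume.prod volume) := (integrable_gaussHat hδ).ofReal.mul_prod hg
    refine h1.mono ?_ (Filter.Eventually.of_forall fun q => ?_)
    · have h2 : Continuous fun q : V × (V × ℝ) => (𝐞 ⟪q.1, x - q.2.1 - q.2.2 • c⟫_ℝ : ℂ) :=
        continuous_subtype_val.comp (Real.continuous_fourierChar.comp (by fun_prop))
      refine (h2.aestronglyMeasurable.mul h1.1).congr (Filter.Eventually.of_forall fun q => ?_)
      simp only [Pi.mul_apply, Function.uncurry, mul_assoc]
    · simp only [Function.uncurry, norm_mul, norm_fourierChar, one_mul, le_refl]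
  have e1 : ∀ ξ : V, 𝐞 ⟪ξ, x⟫_ℝ • gaussAvgHat δ g c ξ =
      ∫ p : V × ℝ, ((𝐞 ⟪ξ, x - p.1 - p.2 • c⟫_ℝ : ℂ) * gaussHat δ ξ) * g p := by
    intro ξ
    rw [Circle.smul_def, smul_eq_mul, gaussAvgHat, fullFourier, ← mul_assoc, ← integral_const_mul]
    refine integral_congr_ae (Filter.Eventually.of_forall fun p => ?_)
    simp only
    rw [show ⟪ξ, x - p.1 - p.2 • c⟫_ℝ = ⟪ξ, x⟫_ℝ + -(⟪p.1, ξ⟫_ℝ + p.2 * ⟪c, ξ⟫_ℝ) by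
      rw [inner_sub_right, inner_sub_right, inner_smul_right, real_inner_comm p.1,
        real_inner_comm c]; ring, AddChar.map_add_eq_mul, Circle.coe_mul]
    ring
  rw [Real.fourierInv_eq]
  simp_rw [e1]
  rw [integral_integral_swap hint, gaussAvg]
  refine integral_congr_ae (Filter.Eventually.of_forall fun p => ?_)
  simp only
  rw [integral_mul_const, ← fourierInv_gaussHat hδ, Real.fourierInv_eq]
  simp_rw [Circle.smul_def, smul_eq_mul]

theorem lintegral_gaussAvg_sq {δ : ℝ} (hδ : 0 < δ) {g : V × ℝ → ℂ} (hg : Integrable g) (c : V) :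
    ∫⁻ x, ‖gaussAvg δ g x c‖ₑ ^ 2 = ∫⁻ ξ, ‖gaussAvgHat δ g c ξ‖ₑ ^ 2 := by
  simp_rw [gaussAvg_eq_fourierInv hδ hg]
  exact lintegral_enorm_fourierInv_sq (integrable_gaussAvgHat hδ hg c)
    (memLp_two_gaussAvgHat hδ hg c)

theorem lintegral_gaussAvg_sub_sq {δ : ℝ} (hδ : 0 < δ) {g : V × ℝ → ℂ} (hg : Integrable g)
    (c c' : V) : ∫⁻ x, ‖gaussAvg δ g x c - gaussAvg δ g x c'‖ₑ ^ 2 =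
      ∫⁻ ξ, ‖gaussAvgHat δ g c ξ - gaussAvgHat δ g c' ξ‖ₑ ^ 2 := by
  have i1 := integrable_gaussAvgHat hδ hg c
  have i2 := integrable_gaussAvgHat hδ hg c'
  have e : ∀ x, gaussAvg δ g x c - gaussAvg δ g x c' =
      𝓕⁻ (gaussAvgHat δ g c - gaussAvgHat δ g c') x := by
    intro x
    rw [gaussAvg_eq_fourierInv hδ hg, gaussAvg_eq_fourierInv hδ hg]
    simp_rw [Real.fourierInv_eq_fourier_neg, Real.fourier_eq, Pi.sub_apply, smul_sub]
    rw [integral_sub]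
    · exact (Real.fourierIntegral_convergent_iff _).2 i1
    · exact (Real.fourierIntegral_convergent_iff _).2 i2
  simp_rw [e]
  exact lintegral_enorm_fourierInv_sq (i1.sub i2)
    ((memLp_two_gaussAvgHat hδ hg c).sub (memLp_two_gaussAvgHat hδ hg c'))

theorem lintegral_gagliardo {P : V → ℝ → ℂ} (hP : Continuous fun q : V × ℝ => P q.1 q.2)
    (α β ε : ℝ) : ∫⁻ x, gagliardo α β ε (P x) = ∫⁻ r in Icc α β, ∫⁻ u in Icc α β,
      ENNReal.ofReal (((|r - u| + ε) ^ 2)⁻¹) * ∫⁻ x, ‖P x r - P x u‖ₑ ^ 2 := by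
  have hk := measurable_gagliardo_kernel ε
  have m3 : Measurable fun q : (V × ℝ) × ℝ =>
      ENNReal.ofReal (((|q.1.2 - q.2| + ε) ^ 2)⁻¹) * ‖P q.1.1 q.1.2 - P q.1.1 q.2‖ₑ ^ 2 := by
    have hc : Continuous fun q : (V × ℝ) × ℝ => P q.1.1 q.1.2 - P q.1.1 q.2 :=
      (hP.comp (f := fun q : (V × ℝ) × ℝ => q.1) (by fun_prop)).sub
        (hP.comp (f := fun q : (V × ℝ) × ℝ => (q.1.1, q.2)) (by fun_prop))
    exact (hk.comp (measurable_fst.snd.prodMk measurable_snd)).mul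
      (hc.enorm.measurable.pow_const 2)
  unfold gagliardo
  rw [lintegral_lintegral_swap (m3.lintegral_prod_right' (ν := volume.restrict (Icc α β))).aemeasurable]
  refine lintegral_congr fun r => ?_
  have m2 : Measurable fun q : V × ℝ =>
      ENNReal.ofReal (((|r - q.2| + ε) ^ 2)⁻¹) * ‖P q.1 r - P q.1 q.2‖ₑ ^ 2 :=
    m3.comp (f := fun q : V × ℝ => ((q.1, r), q.2)) (by fun_prop)
  rw [lintegral_lintegral_swap m2.aemeasurable]
  refine lintegral_congr fun u => ?_
  rw [lintegral_const_mul' _ _ ENNReal.ofReal_ne_top]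

/-- The energy is a weighted integral of squared differences in `s`, so Plancherel in `x` applies
for each pair of parameters under the integral. -/
theorem lintegral_gagliardo_gaussAvg {δ : ℝ} (hδ : 0 < δ) {g : V × ℝ → ℂ} (hg : Integrable g)
    {c : ℝ → V} (hc : Continuous c) (α β ε : ℝ) :
    ∫⁻ x, gagliardo α β ε (fun s => gaussAvg δ g x (c s)) =
      ∫⁻ ξ, gagliardo α β ε (fun s => gaussAvgHat δ g (c s) ξ) := by
  rw [lintegral_gagliardo ((continuous_gaussAvg hδ hg).comp
      (f := fun q : V × ℝ => (q.1, c q.2)) (by fun_prop)),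
    lintegral_gagliardo (P := fun ξ s => gaussAvgHat δ g (c s) ξ) ((continuous_gaussAvgHat δ hg).comp
      (f := fun q : V × ℝ => (c q.2, q.1)) (by fun_prop))]
  simp_rw [lintegral_gaussAvg_sub_sq hδ hg]

theorem lintegral_setLIntegral_gaussAvg {δ : ℝ} (hδ : 0 < δ) {g : V × ℝ → ℂ} (hg : Integrable g)
    {c : ℝ → V} (hc : Continuous c) (J : Set ℝ) :
    ∫⁻ x, ∫⁻ s in J, ‖gaussAvg δ g x (c s)‖ₑ ^ 2 =
      ∫⁻ ξ, ∫⁻ s in J, ‖gaussAvgHat δ g (c s) ξ‖ₑ ^ 2 := by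
  have c1 : Continuous fun q : V × ℝ => gaussAvg δ g q.1 (c q.2) :=
    (continuous_gaussAvg hδ hg).comp (f := fun q : V × ℝ => (q.1, c q.2)) (by fun_prop)
  have c2 : Continuous fun q : V × ℝ => gaussAvgHat δ g (c q.2) q.1 :=
    (continuous_gaussAvgHat δ hg).comp (f := fun q : V × ℝ => (c q.2, q.1)) (by fun_prop)
  rw [lintegral_lintegral_swap (c1.enorm.measurable.pow_const 2).aemeasurable,
    lintegral_lintegral_swap (f := fun ξ s => ‖gaussAvgHat δ g (c s) ξ‖ₑ ^ 2) (c2.enorm.measurable.pow_const 2).aemeasurable]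
  simp_rw [lintegral_gaussAvg_sq hδ hg]

end Kernel

end Nikodym

namespace Nikodym

/-! ### The energy estimate, frequency by frequency. -/

section Energy

open FourierTransform Real
open scoped InnerProductSpace

set_option linter.unusedSectionVars false

variable {V : Type*} [NormedAddCommGroup V] [InnerProductSpace ℝ V] [FiniteDimensional ℝ V]
  [MeasurableSpace V] [BorelSpace V]

theorem log_ratio_le {l δ : ℝ} (hl : 0 < l) (hδ : 0 < δ) (hδ1 : δ < 1) :
    Real.log ((2 * l + l * δ) / (l * δ)) ≤ 3 * max 1 (Real.log δ⁻¹) := by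
  have h1 : (2 * l + l * δ) / (l * δ) ≤ 3 * δ⁻¹ := by
    rw [div_le_iff₀ (by positivity)]
    field_simp
    linarith
  calc Real.log ((2 * l + l * δ) / (l * δ)) ≤ Real.log (3 * δ⁻¹) :=
        Real.log_le_log (by positivity) h1
    _ = Real.log 3 + Real.log δ⁻¹ := Real.log_mul (by norm_num) (by positivity)
    _ ≤ 2 + Real.log δ⁻¹ := by
        have := Real.log_le_sub_one_of_pos (show (0 : ℝ) < 3 by norm_num)
        linarith
    _ ≤ _ := by linarith [le_max_left 1 (Real.log δ⁻¹), le_max_right 1 (Real.log δ⁻¹)]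

variable {Γ : ℕ → ℝ → V} {α β T c δ : ℝ} {d : ℕ} {g : V × ℝ → ℂ}

theorem log_mul_gagliardo_gaussAvgHat_le (hαβ : α < β) (hΓ : ∀ j, Continuous (Γ j))
    (hd : ∀ j, ∀ s ∈ Ioo α β, HasDerivAt (Γ j) (Γ (j + 1) s) s)
    (hT : ∀ s ∈ Icc α β, ‖Γ 1 s‖ ≤ T) (hc : 0 < c)
    (hnd : ∀ ξ : V, ξ ≠ 0 → ∃ k < d, ∀ s ∈ Icc α β, c * ‖ξ‖ ≤ |⟪Γ (k + 1) s, ξ⟫_ℝ|)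
    (hδ : 0 < δ) (hδ1 : δ < 1) (hm : StronglyMeasurable g) (hg : Integrable g)
    (hs : ∀ p : V × ℝ, p.2 ∉ I → g p = 0) {ξ : V}
    (hξ : ∫⁻ t, ‖partialFourier g ξ t‖ₑ ^ 2 ≠ ⊤) :
    ENNReal.ofReal (Real.log δ⁻¹) *
      gagliardo α β ((β - α) / 2 * δ) (fun s => gaussAvgHat δ g (Γ 0 s) ξ) ≤
    ENNReal.ofReal ((160 * (π * (T + 4 / c)) + 3120 * d) * max 1 (Real.log δ⁻¹) ^ d) *
      ∫⁻ t, ‖partialFourier g ξ t‖ₑ ^ 2 := by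
  set N := ∫⁻ t, ‖partialFourier g ξ t‖ₑ ^ 2 with hN
  set L := max 1 (Real.log δ⁻¹) with hL
  set ε := (β - α) / 2 * δ with hε
  have hL1 : 1 ≤ L := le_max_left _ _
  have hlogL : Real.log δ⁻¹ ≤ L := le_max_right _ _
  have hε0 : 0 < ε := by
    have : 0 < β - α := by linarith
    positivity
  have hT0 : 0 ≤ T := (norm_nonneg _).trans (hT α ⟨le_rfl, hαβ.le⟩)
  set f := partialFourier g ξ with hf
  have if1 : Integrable f := integrable_partialFourier hm hg ξ
  have if2 : MemLp f 2 := by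
    refine ⟨if1.1, lt_top_iff_ne_top.2 fun h => hξ ?_⟩
    rw [hN, lintegral_enorm_sq_eq_eLpNorm, h]
    simp
  have fs : ∀ t, t ∉ I → f t = 0 := by
    intro t ht
    simp [hf, partialFourier, Real.fourier_eq, hs _ (show ((_ : V), t).2 ∉ I from ht)]
  obtain ⟨G', hG, hG'c, b1, b2, b3⟩ := fourier_band_limited if1 if2 fs
  have hB : (40 * N : ℝ≥0∞) ≠ ⊤ := ENNReal.mul_ne_top (by norm_num) hξ
  have hGc : Continuous (𝓕 f) := continuous_fourier if1
  have reduce : gagliardo α β ε (fun s => gaussAvgHat δ g (Γ 0 s) ξ) ≤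
      gagliardo α β ε (fun s => 𝓕 f ⟪Γ 0 s, ξ⟫_ℝ) := by
    simp_rw [gaussAvgHat, fullFourier_eq_fourier_partialFourier hg]
    rw [gagliardo_const_mul]
    refine mul_le_of_le_one_left zero_le (pow_le_one₀ zero_le ?_)
    rw [← ofReal_norm, Complex.norm_real, Real.norm_of_nonneg (gaussHat_pos δ ξ).le]
    exact ENNReal.ofReal_le_one.2 (gaussHat_le_one δ ξ)
  refine (mul_le_mul_right reduce _).trans ?_
  set H : ℕ → ℝ → ℝ := fun j s => ⟪Γ j s, ξ⟫_ℝ with hH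
  have cH : ∀ j, Continuous (H j) := fun j => (hΓ j).inner continuous_const
  have dH : ∀ j, ∀ s ∈ Ioo α β, HasDerivAt (H j) (H (j + 1) s) s := fun j s hs => by
    simpa [hH] using (hd j s hs).inner ℝ (hasDerivAt_const s ξ)
  -- At frequency zero the function is constant in `s`. When `d = 0` this is the only case, as the
  -- non-degeneracy hypothesis then provides no `k`.
  by_cases h0 : ξ = 0
  · simp [h0, gagliardo_const]
  have hR : 0 < ‖ξ‖ := norm_pos_iff.2 h0
  obtain ⟨k, hkd, hk⟩ := hnd ξ h0
  -- If the first derivative detects `ξ`, the total is one logarithm and `0 < d` gives `L ≤ L ^ d`.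
  -- Otherwise it is two logarithms, and `k + 1 < d` forces `d ≥ 2`, so `L ^ 2 ≤ L ^ d`.
  rcases k with _ | k
  · have key := gagliardo_comp_le_of_deriv hαβ.le hε0 cH dH hG hG'c hB b1 b2 hR hc hk
      (T := T) (fun s hs => (abs_real_inner_le_norm _ _).trans
        (mul_le_mul_of_nonneg_right (hT s hs) (norm_nonneg _))) hT0
    calc ENNReal.ofReal (Real.log δ⁻¹) * gagliardo α β ε (fun s => 𝓕 f (H 0 s))
        ≤ ENNReal.ofReal L * (4 * (ENNReal.ofReal π * (ENNReal.ofReal (T + 4 / c) * (40 * N)))) := by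
          gcongr
      _ = ENNReal.ofReal (160 * (π * (T + 4 / c)) * L) * N := by
          rw [ENNReal.ofReal_mul (by positivity), ENNReal.ofReal_mul (by positivity),
            ENNReal.ofReal_mul (by positivity), ENNReal.ofReal_ofNat,
            show (160 : ℝ≥0∞) = 4 * 40 by norm_num]
          ring
      _ ≤ _ := by
          gcongr
          · exact le_add_of_nonneg_right (by positivity)
          · exact le_self_pow₀ hL1 (by omega)
  · have key := gagliardo_comp_le_of_iterated_deriv hαβ.le hε0 cH dH hG hG'c hB b1 b2 b3 (k := k)
      fun s hs h => by
        have := hk s (Ioo_subset_Icc_self hs)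
        rw [show ⟪Γ (k + 1 + 1) s, ξ⟫_ℝ = 0 from h, abs_zero] at this
        exact absurd this (not_le.2 (by positivity))
    have hlr : Real.log ((β - α + ε) / ε) ≤ 3 * L := by
      have := log_ratio_le (l := (β - α) / 2) (by linarith) hδ hδ1
      rwa [show 2 * ((β - α) / 2) = β - α by ring] at this
    calc ENNReal.ofReal (Real.log δ⁻¹) * gagliardo α β ε (fun s => 𝓕 f (H 0 s))
        ≤ ENNReal.ofReal L * (2 * (ENNReal.ofReal (3 * L) * (13 * ((d : ℕ) * (40 * N))))) := by
          refine mul_le_mul' (ENNReal.ofReal_le_ofReal hlogL) (key.trans ?_)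
          gcongr
          omega
      _ = ENNReal.ofReal (3120 * d * L ^ 2) * N := by
          rw [ENNReal.ofReal_mul (by positivity), ENNReal.ofReal_mul (by positivity),
            ENNReal.ofReal_mul (by positivity), ENNReal.ofReal_pow (by positivity),
            ENNReal.ofReal_ofNat, ENNReal.ofReal_ofNat, ENNReal.ofReal_natCast,
            show (3120 : ℝ≥0∞) = 2 * 3 * 13 * 40 by norm_num]
          ring
      _ ≤ _ := by
          gcongr
          · exact le_add_of_nonneg_left (by positivity)
          · omega

theorem setLIntegral_gaussAvgHat_sq_le (hm : StronglyMeasurable g) (hg : Integrable g)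
    (hs : ∀ p : V × ℝ, p.2 ∉ I → g p = 0) (δ α β : ℝ) (C : ℝ → V) {ξ : V}
    (hξ : ∫⁻ t, ‖partialFourier g ξ t‖ₑ ^ 2 ≠ ⊤) :
    ∫⁻ s in Icc α β, ‖gaussAvgHat δ g (C s) ξ‖ₑ ^ 2 ≤
      ENNReal.ofReal (40 * (β - α)) * ∫⁻ t, ‖partialFourier g ξ t‖ₑ ^ 2 := by
  have if1 : Integrable (partialFourier g ξ) := integrable_partialFourier hm hg ξ
  have if2 : MemLp (partialFourier g ξ) 2 := by
    refine ⟨if1.1, lt_top_iff_ne_top.2 fun h => hξ ?_⟩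
    rw [lintegral_enorm_sq_eq_eLpNorm, h]
    simp
  have fs : ∀ t, t ∉ I → partialFourier g ξ t = 0 := by
    intro t ht
    simp [partialFourier, Real.fourier_eq, hs _ (show ((_ : V), t).2 ∉ I from ht)]
  obtain ⟨-, -, -, -, -, b3⟩ := fourier_band_limited if1 if2 fs
  calc ∫⁻ s in Icc α β, ‖gaussAvgHat δ g (C s) ξ‖ₑ ^ 2
      ≤ ∫⁻ _ in Icc α β, 40 * ∫⁻ t, ‖partialFourier g ξ t‖ₑ ^ 2 := by
        refine lintegral_mono fun s => ?_
        simp only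
        rw [gaussAvgHat, enorm_mul, mul_pow, fullFourier_eq_fourier_partialFourier hg]
        refine (mul_le_of_le_one_left zero_le (pow_le_one₀ zero_le ?_)).trans (b3 _)
        rw [← ofReal_norm, Complex.norm_real, Real.norm_of_nonneg (gaussHat_pos δ ξ).le]
        exact ENNReal.ofReal_le_one.2 (gaussHat_le_one δ ξ)
    _ = _ := by
        rw [lintegral_const, Measure.restrict_apply_univ, Real.volume_Icc,
          ENNReal.ofReal_mul (by norm_num), ENNReal.ofReal_ofNat]
        ring

/-- The pointwise majorant of the square of the maximal function. -/
noncomputable def energy (α β δ : ℝ) (g : V × ℝ → ℂ) (C : ℝ → V) (x : V) : ℝ≥0∞ :=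
  ENNReal.ofReal (4 / (β - α)) * (∫⁻ s in Icc α β, ‖gaussAvg δ g x (C s)‖ₑ ^ 2) +
    ENNReal.ofReal (8 * Real.log δ⁻¹) *
      gagliardo α β ((β - α) / 2 * δ) (fun s => gaussAvg δ g x (C s))

theorem measurable_energy (hδ : 0 < δ) (hg : Integrable g) {C : ℝ → V} (hC : Continuous C)
    (α β : ℝ) : Measurable (energy α β δ g C) := by
  have c1 : Continuous fun q : V × ℝ => gaussAvg δ g q.1 (C q.2) :=
    (continuous_gaussAvg hδ hg).comp (f := fun q : V × ℝ => (q.1, C q.2)) (by fun_prop)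
  have m1 : Measurable fun x => ∫⁻ s in Icc α β, ‖gaussAvg δ g x (C s)‖ₑ ^ 2 :=
    (c1.enorm.measurable.pow_const 2).lintegral_prod_right'
  have m3 : Measurable fun q : (V × ℝ) × ℝ =>
      ENNReal.ofReal (((|q.1.2 - q.2| + (β - α) / 2 * δ) ^ 2)⁻¹) *
        ‖gaussAvg δ g q.1.1 (C q.1.2) - gaussAvg δ g q.1.1 (C q.2)‖ₑ ^ 2 := by
    have hc : Continuous fun q : (V × ℝ) × ℝ =>
        gaussAvg δ g q.1.1 (C q.1.2) - gaussAvg δ g q.1.1 (C q.2) :=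
      (c1.comp (f := fun q : (V × ℝ) × ℝ => q.1) (by fun_prop)).sub
        (c1.comp (f := fun q : (V × ℝ) × ℝ => (q.1.1, q.2)) (by fun_prop))
    exact ((measurable_gagliardo_kernel _).comp (measurable_fst.snd.prodMk measurable_snd)).mul
      (hc.enorm.measurable.pow_const 2)
  exact (m1.const_mul _).add ((m3.lintegral_prod_right'.lintegral_prod_right').const_mul _)

theorem lintegral_energy_le (hαβ : α < β) (hΓ : ∀ j, Continuous (Γ j))
    (hd : ∀ j, ∀ s ∈ Ioo α β, HasDerivAt (Γ j) (Γ (j + 1) s) s)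
    (hT : ∀ s ∈ Icc α β, ‖Γ 1 s‖ ≤ T) (hc : 0 < c)
    (hnd : ∀ ξ : V, ξ ≠ 0 → ∃ k < d, ∀ s ∈ Icc α β, c * ‖ξ‖ ≤ |⟪Γ (k + 1) s, ξ⟫_ℝ|)
    (hδ : 0 < δ) (hδ1 : δ < 1) (hm : StronglyMeasurable g) (hg : Integrable g)
    (hg2 : ∫⁻ p, ‖g p‖ₑ ^ 2 ≠ ⊤) (hs : ∀ p : V × ℝ, p.2 ∉ I → g p = 0) :
    ∫⁻ x, energy α β δ g (Γ 0) x ≤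
      ENNReal.ofReal ((160 + 8 * (160 * (π * (T + 4 / c)) + 3120 * d)) *
        max 1 (Real.log δ⁻¹) ^ d) * ∫⁻ p, ‖g p‖ₑ ^ 2 := by
  set L := max 1 (Real.log δ⁻¹) with hL
  set K := 160 * (π * (T + 4 / c)) + 3120 * d with hK
  have hT0 : 0 ≤ T := (norm_nonneg _).trans (hT α ⟨le_rfl, hαβ.le⟩)
  have hK0 : 0 ≤ K := by positivity
  have hL1 : 1 ≤ L := le_max_left _ _
  have hba : 0 < β - α := by linarith
  have hpl := lintegral_partialFourier_sq hm hg hg2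
  have mp : Measurable fun ξ => ∫⁻ t, ‖partialFourier g ξ t‖ₑ ^ 2 :=
    ((stronglyMeasurable_partialFourier hm).enorm.pow_const 2).lintegral_prod_right'
  have hfin : ∀ᵐ ξ : V, ∫⁻ t, ‖partialFourier g ξ t‖ₑ ^ 2 ≠ ⊤ := by
    filter_upwards [ae_lt_top mp (by rw [hpl]; exact hg2)] with ξ h using h.ne
  have c1 : Continuous fun q : V × ℝ => gaussAvg δ g q.1 (Γ 0 q.2) :=
    (continuous_gaussAvg hδ hg).comp (f := fun q : V × ℝ => (q.1, Γ 0 q.2)) (by fun_prop)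
  have m1 : Measurable fun x => ∫⁻ s in Icc α β, ‖gaussAvg δ g x (Γ 0 s)‖ₑ ^ 2 :=
    (c1.enorm.measurable.pow_const 2).lintegral_prod_right'
  have i1 : ∫⁻ x, ∫⁻ s in Icc α β, ‖gaussAvg δ g x (Γ 0 s)‖ₑ ^ 2 ≤
      ENNReal.ofReal (40 * (β - α)) * ∫⁻ p, ‖g p‖ₑ ^ 2 := by
    rw [lintegral_setLIntegral_gaussAvg hδ hg (hΓ 0), ← hpl,
      ← lintegral_const_mul' _ _ ENNReal.ofReal_ne_top]
    refine lintegral_mono_ae ?_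
    filter_upwards [hfin] with ξ h using setLIntegral_gaussAvgHat_sq_le hm hg hs δ α β (Γ 0) h
  have i2 : ENNReal.ofReal (Real.log δ⁻¹) *
      ∫⁻ x, gagliardo α β ((β - α) / 2 * δ) (fun s => gaussAvg δ g x (Γ 0 s)) ≤
      ENNReal.ofReal (K * L ^ d) * ∫⁻ p, ‖g p‖ₑ ^ 2 := by
    rw [lintegral_gagliardo_gaussAvg hδ hg (hΓ 0), ← hpl,
      ← lintegral_const_mul' _ _ ENNReal.ofReal_ne_top,
      ← lintegral_const_mul' _ _ ENNReal.ofReal_ne_top]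
    refine lintegral_mono_ae ?_
    filter_upwards [hfin] with ξ h using
      log_mul_gagliardo_gaussAvgHat_le hαβ hΓ hd hT hc hnd hδ hδ1 hm hg hs h
  unfold energy
  rw [lintegral_add_left (m1.const_mul _), lintegral_const_mul _ m1,
    lintegral_const_mul' _ _ ENNReal.ofReal_ne_top, ENNReal.ofReal_mul (by norm_num), mul_assoc]
  refine (add_le_add (mul_le_mul_right i1 _) (mul_le_mul_right i2 _)).trans ?_
  rw [← mul_assoc, ← mul_assoc, ← ENNReal.ofReal_mul (by positivity),
    ← ENNReal.ofReal_mul (by norm_num), ← add_mul, ← ENNReal.ofReal_add (by positivity)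
      (by positivity)]
  gcongr
  -- The length of the interval cancels, and `160 ≤ 160 * L ^ d`.
  rw [show 4 / (β - α) * (40 * (β - α)) = 160 by field_simp; norm_num]
  have := one_le_pow₀ hL1 (n := d)
  linarith

end Energy

end Nikodym

namespace Nikodym

/-! ### The curve: extension of derivatives and quantitative non-degeneracy. -/

section Curve

open scoped InnerProductSpace Topology

variable {d : ℕ} {γ : ℝ → E d}

theorem uniqueDiffOn_I : UniqueDiffOn ℝ I := uniqueDiffOn_Icc (by norm_num)

/-- The `j`-th derivative of `γ` on `[-1, 1]`, extended to `ℝ` by constants. -/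
noncomputable def extendedDeriv (γ : ℝ → E d) (j : ℕ) (s : ℝ) : E d :=
  iteratedDerivWithin j γ I (projIcc (-1) 1 (by norm_num) s : ℝ)

theorem extendedDeriv_of_mem (γ : ℝ → E d) (j : ℕ) {s : ℝ} (hs : s ∈ I) :
    extendedDeriv γ j s = iteratedDerivWithin j γ I s := by
  rw [extendedDeriv, projIcc_of_mem _ hs]

theorem continuous_extendedDeriv (hγ : ContDiffOn ℝ ∞ γ I) (j : ℕ) :
    Continuous (extendedDeriv γ j) := by
  have h := hγ.continuousOn_iteratedDerivWithin (m := j) (by exact_mod_cast le_top) uniqueDiffOn_I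
  exact h.comp_continuous (continuous_subtype_val.comp continuous_projIcc) fun s => Subtype.coe_prop _

theorem hasDerivWithinAt_iteratedDerivWithin (hγ : ContDiffOn ℝ ∞ γ I) (j : ℕ) {s : ℝ}
    (hs : s ∈ I) : HasDerivWithinAt (iteratedDerivWithin j γ I) (iteratedDerivWithin (j + 1) γ I s)
      I s := by
  have h := hγ.differentiableOn_iteratedDerivWithin (m := j)
    (by exact_mod_cast WithTop.coe_lt_top j) uniqueDiffOn_I s hs
  rw [iteratedDerivWithin_succ]
  exact h.hasDerivWithinAt

theorem hasDerivAt_extendedDeriv (hγ : ContDiffOn ℝ ∞ γ I) (j : ℕ) {s : ℝ}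
    (hs : s ∈ Ioo (-1 : ℝ) 1) :
    HasDerivAt (extendedDeriv γ j) (extendedDeriv γ (j + 1) s) s := by
  have hn : I ∈ 𝓝 s := Icc_mem_nhds hs.1 hs.2
  have hsI : s ∈ I := Ioo_subset_Icc_self hs
  rw [extendedDeriv_of_mem γ _ hsI]
  refine ((hasDerivWithinAt_iteratedDerivWithin hγ j hsI).hasDerivAt hn).congr_of_eventuallyEq ?_
  filter_upwards [hn] with r hr using extendedDeriv_of_mem γ j hr

theorem extendedDeriv_zero_of_mem {s : ℝ} (hs : s ∈ I) : extendedDeriv γ 0 s = γ s := by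
  rw [extendedDeriv_of_mem γ 0 hs, iteratedDerivWithin_zero]

theorem exists_norm_deriv_le (hγ : ContDiffOn ℝ ∞ γ I) :
    ∃ T : ℝ, (∀ s ∈ I, ‖extendedDeriv γ 1 s‖ ≤ T) ∧
      ∀ s ∈ I, ∀ r ∈ I, ‖γ s - γ r‖ ≤ T * |s - r| := by
  obtain ⟨T, hT⟩ := isCompact_Icc.exists_bound_of_continuousOn (s := I)
    (continuous_extendedDeriv hγ 1).continuousOn
  refine ⟨T, hT, fun s hs r hr => ?_⟩
  have := (convex_Icc (-1 : ℝ) 1).norm_image_sub_le_of_norm_hasDerivWithin_le (f := γ)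
    (f' := iteratedDerivWithin 1 γ I) (C := T) (fun u hu => by
      simpa only [iteratedDerivWithin_zero] using! hasDerivWithinAt_iteratedDerivWithin hγ 0 hu)
    (fun u hu => by rw [← extendedDeriv_of_mem γ 1 hu]; exact hT u hu) hr hs
  simpa [Real.norm_eq_abs] using this

/-- A vector orthogonal to all the derivatives lies in the left kernel of the matrix with non-zero
determinant. -/
theorem sum_abs_inner_pos (hγ : IsNondegenerate γ) {s : ℝ} (hs : s ∈ I) {e : E d} (he : e ≠ 0) :
    0 < ∑ k : Fin d, |⟪extendedDeriv γ (k + 1) s, e⟫_ℝ| := by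
  refine (Finset.sum_nonneg fun k _ => abs_nonneg _).lt_of_ne' fun h => he ?_
  rw [Finset.sum_eq_zero_iff_of_nonneg fun k _ => abs_nonneg _] at h
  have h0 := Matrix.eq_zero_of_vecMul_eq_zero (v := fun i => e i) (hγ.2 s hs) (by
    ext k
    have := abs_eq_zero.1 (h k (Finset.mem_univ k))
    rw [extendedDeriv_of_mem γ _ hs, PiLp.inner_apply] at this
    simpa [Matrix.vecMul, dotProduct] using this)
  ext i
  exact congrFun h0 i

/-- Quantitative non-degeneracy: on short intervals, each direction is detected by a single
derivative of `γ`. -/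
theorem exists_uniform_nondegenerate (hγ : IsNondegenerate γ) :
    ∃ c : ℝ, 0 < c ∧ ∃ N : ℕ, 0 < N ∧ ∀ a b : ℝ, -1 ≤ a → a ≤ b → b ≤ 1 → b - a ≤ 2 / N →
      ∀ ξ : E d, ξ ≠ 0 → ∃ k < d, ∀ s ∈ Icc a b,
        c * ‖ξ‖ ≤ |⟪extendedDeriv γ (k + 1) s, ξ⟫_ℝ| := by
  have hcont : Continuous fun q : ℝ × E d => ∑ k : Fin d, |⟪extendedDeriv γ (k + 1) q.1, q.2⟫_ℝ| := by
    refine continuous_finsetSum _ fun k _ => ?_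
    exact (((continuous_extendedDeriv hγ.1 (k + 1)).comp continuous_fst).inner continuous_snd).abs
  obtain ⟨m, hm0, hm⟩ := (isCompact_Icc.prod (isCompact_sphere (0 : E d) 1)).exists_forall_le'
    (s := I ×ˢ Metric.sphere (0 : E d) 1) hcont.continuousOn (a := 0) fun q hq => by
      refine sum_abs_inner_pos hγ hq.1 fun h => ?_
      have := hq.2
      simp [h] at this
  -- Chosen so that `d * (2 * c) < m`, including when `d = 0`: a sum of `d` terms reaching `m` has a
  -- term at least `2 * c`, and half of that survives a perturbation of size `c`.
  set c := m / (2 * (d + 1)) with hc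
  have hc0 : 0 < c := by positivity
  have hu : UniformContinuousOn (fun s => fun k : Fin d => extendedDeriv γ (k + 1) s) I :=
    isCompact_Icc.uniformContinuousOn_of_continuous
      (continuous_pi fun k : Fin d => continuous_extendedDeriv hγ.1 (k + 1)).continuousOn
  obtain ⟨η, hη, hη'⟩ := Metric.uniformContinuousOn_iff.1 hu c hc0
  obtain ⟨N, hN⟩ := exists_nat_gt (2 / η)
  have hN0 : (0 : ℝ) < N := lt_of_le_of_lt (by positivity) hN
  refine ⟨c, hc0, N, by exact_mod_cast hN0, fun a b ha hab hb hlen ξ hξ => ?_⟩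
  have hξ0 : 0 < ‖ξ‖ := norm_pos_iff.2 hξ
  have haI : a ∈ I := ⟨ha, hab.trans hb⟩
  set e := ‖ξ‖⁻¹ • ξ with he
  have he1 : ‖e‖ = 1 := by rw [he, norm_smul, norm_inv, norm_norm, inv_mul_cancel₀ hξ0.ne']
  have hξe : ξ = ‖ξ‖ • e := by rw [he, smul_smul, mul_inv_cancel₀ hξ0.ne', one_smul]
  have hsum := hm (a, e) ⟨haI, by simp [he1]⟩
  -- The derivative is selected at the left endpoint only; uniform continuity carries the lower
  -- bound to the whole short interval.
  obtain ⟨k, hk⟩ : ∃ k : Fin d, 2 * c ≤ |⟪extendedDeriv γ (k + 1) a, e⟫_ℝ| := by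
    by_contra! hcon
    have h1 : ∑ k : Fin d, |⟪extendedDeriv γ (k + 1) a, e⟫_ℝ| ≤ ∑ _k : Fin d, 2 * c :=
      Finset.sum_le_sum fun k _ => (hcon k).le
    simp only [Finset.sum_const, Finset.card_univ, Fintype.card_fin, nsmul_eq_mul] at h1
    have h2 : (d : ℝ) * (2 * c) < m := by
      rw [hc]
      field_simp
      linarith
    exact absurd (hsum.trans h1) (not_le.2 h2)
  refine ⟨k, k.2, fun s hs => ?_⟩
  have hsI : s ∈ I := ⟨ha.trans hs.1, hs.2.trans hb⟩
  have hdist : dist s a < η := by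
    rw [Real.dist_eq, abs_of_nonneg (by linarith [hs.1])]
    have : 2 / (N : ℝ) < η := by
      rw [div_lt_iff₀ hN0]
      rw [div_lt_iff₀ hη] at hN
      linarith
    linarith [hs.2]
  have hd1 : ‖extendedDeriv γ (k + 1) s - extendedDeriv γ (k + 1) a‖ < c := by
    have := (dist_le_pi_dist (fun k : Fin d => extendedDeriv γ (k + 1) s)
      (fun k : Fin d => extendedDeriv γ (k + 1) a) k).trans_lt (hη' s hsI a haI hdist)
    rwa [dist_eq_norm] at this
  have h3 : |⟪extendedDeriv γ (k + 1) s - extendedDeriv γ (k + 1) a, e⟫_ℝ| ≤ c :=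
    (abs_real_inner_le_norm _ _).trans (by rw [he1, mul_one]; exact hd1.le)
  have h4 : c ≤ |⟪extendedDeriv γ (k + 1) s, e⟫_ℝ| := by
    rw [inner_sub_left, abs_sub_comm] at h3
    have := abs_sub_abs_le_abs_sub ⟪extendedDeriv γ (k + 1) a, e⟫_ℝ
      ⟪extendedDeriv γ (k + 1) s, e⟫_ℝ
    linarith
  calc c * ‖ξ‖ ≤ |⟪extendedDeriv γ (k + 1) s, e⟫_ℝ| * ‖ξ‖ := by gcongr
    _ = |⟪extendedDeriv γ (k + 1) s, ‖ξ‖ • e⟫_ℝ| := by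
      rw [inner_smul_right _ e, abs_mul, abs_norm, mul_comm]
    _ = _ := by rw [← hξe]

end Curve

end Nikodym

namespace Nikodym

/-! ### Tubes, and measurability of the maximal function. -/

section Tube

open scoped Topology

variable {d : ℕ} {γ : ℝ → E d} {δ s : ℝ} {g : E d × ℝ → ℂ}

theorem isClosed_tube (γ : ℝ → E d) (δ s : ℝ) : IsClosed (tube γ δ s) := by
  have h1 : IsClosed {p : E d × ℝ | p.2 ∈ I} := isClosed_Icc.preimage continuous_snd
  have h2 : IsClosed {p : E d × ℝ | ‖p.1 - p.2 • γ s‖ ≤ δ} :=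
    isClosed_le (by fun_prop) continuous_const
  exact h1.inter h2

theorem volume_tube (hδ : 0 < δ) (γ : ℝ → E d) (s : ℝ) :
    volume (tube γ δ s) = ENNReal.ofReal (δ ^ d) * (2 * volume (Metric.ball (0 : E d) 1)) := by
  rw [Measure.volume_eq_prod, Measure.prod_apply_symm (isClosed_tube γ δ s).measurableSet]
  have e : ∀ t : ℝ, volume ((fun y : E d => (y, t)) ⁻¹' tube γ δ s) =
      I.indicator (fun _ => ENNReal.ofReal (δ ^ d) * volume (Metric.ball (0 : E d) 1)) t := by
    intro t
    by_cases ht : t ∈ I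
    · rw [indicator_of_mem ht]
      have : (fun y : E d => (y, t)) ⁻¹' tube γ δ s = Metric.closedBall (t • γ s) δ := by
        ext y
        simp [tube, ht, dist_eq_norm]
      rw [this, Measure.addHaar_closedBall _ _ hδ.le, finrank_euclideanSpace, Fintype.card_fin]
    · rw [indicator_of_notMem ht]
      have : (fun y : E d => (y, t)) ⁻¹' tube γ δ s = ∅ := by
        ext y
        simp [tube, ht]
      rw [this, measure_empty]
  simp_rw [e]
  rw [lintegral_indicator (show MeasurableSet I from measurableSet_Icc), lintegral_const, Measure.restrict_apply_univ, I,
    Real.volume_Icc]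
  norm_num
  ring

theorem measurePreserving_reflect (x : E d) :
    MeasurePreserving (fun p : E d × ℝ => (x - p.1, p.2)) :=
  (Measure.measurePreserving_sub_left volume x).prod (MeasurePreserving.id volume)

theorem measurableEmbedding_reflect (x : E d) :
    MeasurableEmbedding (fun p : E d × ℝ => (x - p.1, p.2)) :=
  (Homeomorph.prodCongr (Homeomorph.subLeft x) (Homeomorph.refl ℝ)).measurableEmbedding

/-- The equality holds for every `x` and `s`, because reflection and translation preserve null sets.
Hence the uncountable supremum depends only on the class of `g`. -/
theorem avg_congr_ae {g' : E d × ℝ → ℂ} (h : g =ᵐ[volume] g') (γ : ℝ → E d) (δ : ℝ) :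
    avg γ δ g = avg γ δ g' := by
  ext x s
  have h1 := (measurePreserving_reflect x).quasiMeasurePreserving.ae_eq_comp h
  exact integral_congr_ae (Measure.ae_smul_measure (ae_restrict_of_ae h1) _)

theorem setIntegral_tube_eq (γ : ℝ → E d) (δ s : ℝ) (g : E d × ℝ → ℂ) (x : E d) :
    ∫ p in tube γ δ s, g (x - p.1, p.2) =
      ∫ q, (tube γ δ s).indicator (fun _ => (1 : ℂ)) (x - q.1, q.2) * g q := by
  rw [← integral_indicator (isClosed_tube γ δ s).measurableSet,
    ← (measurePreserving_reflect x).integral_comp (measurableEmbedding_reflect x)]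
  refine integral_congr_ae (Filter.Eventually.of_forall fun p => ?_)
  simp only
  by_cases hp : (x - p.1, p.2) ∈ tube γ δ s
  · rw [indicator_of_mem hp, indicator_of_mem hp, one_mul, sub_sub_cancel]
  · rw [indicator_of_notMem hp, indicator_of_notMem hp, zero_mul]

theorem volume_tube_boundary (hδ : 0 < δ) (x c : E d) :
    volume {q : E d × ℝ | ‖x - q.1 - q.2 • c‖ = δ} = 0 := by
  have hm : MeasurableSet {q : E d × ℝ | ‖x - q.1 - q.2 • c‖ = δ} :=
    (isClosed_eq (by fun_prop) continuous_const).measurableSet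
  rw [Measure.volume_eq_prod, Measure.prod_apply_symm hm]
  refine lintegral_eq_zero_of_ae_eq_zero (Filter.Eventually.of_forall fun t => ?_)
  have : (fun y : E d => (y, t)) ⁻¹' {q : E d × ℝ | ‖x - q.1 - q.2 • c‖ = δ} =
      Metric.sphere (x - t • c) δ := by
    ext y
    simp only [mem_preimage, mem_ofPred_eq, mem_sphere_iff_norm]
    rw [← norm_neg]
    congr! 2
    abel
  simp only [this, Pi.zero_apply]
  exact Measure.addHaar_sphere_of_ne_zero _ _ hδ.ne'

/-- As `x` varies near `x₀`, the indicator can jump at `x₀` only for `q` on the lateral boundary of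
the translated tube, a null set; `|g|` on a fixed compact set dominates. -/
theorem continuous_setIntegral_tube (hδ : 0 < δ) (hg : MemLp g 2) (γ : ℝ → E d) (s : ℝ) :
    Continuous fun x => ∫ p in tube γ δ s, g (x - p.1, p.2) := by
  simp_rw [setIntegral_tube_eq]
  refine continuous_iff_continuousAt.2 fun x₀ => ?_
  set S : Set (E d × ℝ) := Metric.closedBall 0 (‖x₀‖ + 1 + δ + ‖γ s‖) ×ˢ I with hS
  have cS : IsCompact S := (isCompact_closedBall _ _).prod isCompact_Icc
  have hgS : IntegrableOn g S :=
    (hg.locallyIntegrable (by norm_num)).integrableOn_isCompact cS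
  refine continuousAt_of_dominated (bound := S.indicator fun q => ‖g q‖) ?_ ?_ ?_ ?_
  · refine Filter.Eventually.of_forall fun x => AEStronglyMeasurable.mul ?_ hg.1
    have hm : Measurable ((tube γ δ s).indicator fun _ => (1 : ℂ)) :=
      measurable_const.indicator (isClosed_tube γ δ s).measurableSet
    exact (hm.comp (by fun_prop : Measurable fun q : E d × ℝ => (x - q.1, q.2))).aestronglyMeasurable
  · filter_upwards [Metric.ball_mem_nhds x₀ one_pos] with x hx
    refine Filter.Eventually.of_forall fun q => ?_
    by_cases hq : (x - q.1, q.2) ∈ tube γ δ s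
    · rw [indicator_of_mem hq, one_mul, indicator_of_mem]
      refine ⟨?_, hq.1⟩
      have h1 : ‖x - q.1 - q.2 • γ s‖ ≤ δ := hq.2
      have h2 : ‖q.2 • γ s‖ ≤ ‖γ s‖ := by
        rw [norm_smul, Real.norm_eq_abs]
        exact mul_le_of_le_one_left (norm_nonneg _) (abs_le.2 hq.1)
      have h3 : ‖x - x₀‖ < 1 := by simpa [dist_eq_norm] using hx
      have e : q.1 = (x - x₀) + x₀ - (x - q.1 - q.2 • γ s) - q.2 • γ s := by abel
      rw [mem_closedBall_zero_iff, e]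
      have t1 := norm_sub_le ((x - x₀) + x₀ - (x - q.1 - q.2 • γ s)) (q.2 • γ s)
      have t2 := norm_sub_le ((x - x₀) + x₀) (x - q.1 - q.2 • γ s)
      have t3 := norm_add_le (x - x₀) x₀
      linarith
    · rw [indicator_of_notMem hq, zero_mul, norm_zero]
      exact indicator_nonneg (fun _ _ => norm_nonneg _) _
  · exact (integrable_indicator_iff cS.measurableSet).2 hgS.norm
  · have hne : ∀ᵐ q : E d × ℝ, ‖x₀ - q.1 - q.2 • γ s‖ ≠ δ := by
      rw [ae_iff]
      simpa using volume_tube_boundary hδ x₀ (γ s)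
    filter_upwards [hne] with q hq
    refine ContinuousAt.mul ?_ continuousAt_const
    have hcn : Continuous fun x : E d => ‖x - q.1 - q.2 • γ s‖ := by fun_prop
    by_cases ht : q.2 ∈ I
    · rcases lt_or_gt_of_ne hq with h | h
      · refine (continuousAt_const (y := (1 : ℂ))).congr ?_
        filter_upwards [hcn.continuousAt.eventually_lt_const h] with x hx
        rw [indicator_of_mem]
        exact ⟨ht, hx.le⟩
      · refine (continuousAt_const (y := (0 : ℂ))).congr ?_
        filter_upwards [hcn.continuousAt.eventually_const_lt h] with x hx
        rw [indicator_of_notMem]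
        exact fun hm => absurd hm.2 (not_le.2 hx)
    · refine (continuousAt_const (y := (0 : ℂ))).congr (Filter.Eventually.of_forall fun x => ?_)
      exact (indicator_of_notMem (fun hm => ht hm.1) _).symm

theorem continuous_avg (hδ : 0 < δ) (hg : MemLp g 2) (γ : ℝ → E d) (s : ℝ) :
    Continuous fun x => avg γ δ g x s := by
  simp_rw [avg, setAverage_eq]
  exact (continuous_setIntegral_tube hδ hg γ s).const_smul _

/-- The supremum is over an uncountable set, but a supremum of continuous functions is lower
semicontinuous. -/
theorem measurable_maximal (hδ : 0 < δ) (hg : MemLp g 2) (γ : ℝ → E d) :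
    Measurable (maximal γ δ g) := by
  refine LowerSemicontinuous.measurable ?_
  exact lowerSemicontinuous_biSup fun s _ => (continuous_avg hδ hg γ s).enorm.lowerSemicontinuous

theorem enorm_avg_le (γ : ℝ → E d) (δ : ℝ) (g : E d × ℝ → ℂ) (x : E d) (s : ℝ) :
    ‖avg γ δ g x s‖ₑ ≤
      (volume (tube γ δ s))⁻¹ * ∫⁻ p in tube γ δ s, ‖g (x - p.1, p.2)‖ₑ := by
  refine (enorm_integral_le_lintegral_enorm _).trans (le_of_eq ?_)
  rw [lintegral_smul_measure, Measure.restrict_apply_univ, smul_eq_mul]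

end Tube

end Nikodym

namespace Nikodym

/-! ### Pointwise domination of tube averages by the energy. -/

section Pointwise

open scoped Topology

variable {d : ℕ} {γ : ℝ → E d} {δ s T : ℝ}

/-- The Gaussian average of a real function along the line in direction `c` through `x`. -/
noncomputable def gaussAvgReal (δ : ℝ) (h : E d × ℝ → ℝ) (x c : E d) : ℝ :=
  ∫ p : E d × ℝ, gauss δ (x - p.1 - p.2 • c) * h p

theorem gaussAvg_ofReal (δ : ℝ) (h : E d × ℝ → ℝ) (x c : E d) :
    gaussAvg δ (fun p => (h p : ℂ)) x c = gaussAvgReal δ h x c := by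
  rw [gaussAvg, gaussAvgReal, ← integral_complex_ofReal]
  simp

theorem ofReal_gaussAvgReal (hδ : 0 < δ) {h : E d × ℝ → ℝ} (h0 : ∀ p, 0 ≤ h p)
    (hi : Integrable h) (x c : E d) : ENNReal.ofReal (gaussAvgReal δ h x c) =
      ∫⁻ p : E d × ℝ, ENNReal.ofReal (gauss δ (x - p.1 - p.2 • c)) * ENNReal.ofReal (h p) := by
  rw [gaussAvgReal, ofReal_integral_eq_lintegral_ofReal]
  · simp_rw [ENNReal.ofReal_mul (gauss_nonneg hδ _)]
  · refine (hi.norm.const_mul (δ ^ Module.finrank ℝ (E d))⁻¹).mono'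
      (AEStronglyMeasurable.mul (Continuous.aestronglyMeasurable ?_) hi.1)
      (Filter.Eventually.of_forall fun p => ?_)
    · exact (continuous_gauss δ).comp (by fun_prop)
    · rw [norm_mul, Real.norm_of_nonneg (gauss_nonneg hδ _)]
      exact mul_le_mul_of_nonneg_right (gauss_le hδ _) (norm_nonneg _)
  · exact Filter.Eventually.of_forall fun p => mul_nonneg (gauss_nonneg hδ _) (h0 p)

/-- Replacing `s` by `r` with `|s - r| ≤ δ` moves the axis by at most `T * δ` because `|t| ≤ 1`. A
point of the tube is thus within `(1 + T) * δ` of the new axis, where the Gaussian is at least `δ ^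
(-d) * exp (-π (1 + T)²)`. -/
theorem one_le_gauss_of_mem_tube (hδ : 0 < δ) (hT : ∀ s ∈ I, ∀ r ∈ I, ‖γ s - γ r‖ ≤ T * |s - r|)
    (hT0 : 0 ≤ T) {r : ℝ} (hs : s ∈ I) (hr : r ∈ I) (hsr : |s - r| ≤ δ) {p : E d × ℝ}
    (hp : p ∈ tube γ δ s) :
    1 ≤ δ ^ d * Real.exp (Real.pi * (1 + T) ^ 2) * gauss δ (p.1 - p.2 • γ r) := by
  have h1 : ‖p.1 - p.2 • γ r‖ ≤ (1 + T) * δ := by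
    have e : p.1 - p.2 • γ r = (p.1 - p.2 • γ s) + p.2 • (γ s - γ r) := by
      rw [smul_sub]
      abel
    have h2 : ‖p.2 • (γ s - γ r)‖ ≤ T * δ := by
      rw [norm_smul, Real.norm_eq_abs]
      calc |p.2| * ‖γ s - γ r‖ ≤ 1 * (T * δ) := by
            gcongr
            · exact abs_le.2 hp.1
            · exact (hT s hs r hr).trans (by gcongr)
        _ = _ := one_mul _
    rw [e]
    refine (norm_add_le _ _).trans ?_
    have := hp.2
    linarith
  have h3 : ‖p.1 - p.2 • γ r‖ ^ 2 / δ ^ 2 ≤ (1 + T) ^ 2 := by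
    rw [div_le_iff₀ (by positivity), ← mul_pow]
    gcongr
  rw [gauss, finrank_euclideanSpace, Fintype.card_fin,
    show δ ^ d * Real.exp (Real.pi * (1 + T) ^ 2) * ((δ ^ d)⁻¹ *
      Real.exp (-Real.pi * ‖p.1 - p.2 • γ r‖ ^ 2 / δ ^ 2)) =
      Real.exp (Real.pi * (1 + T) ^ 2) * Real.exp (-Real.pi * ‖p.1 - p.2 • γ r‖ ^ 2 / δ ^ 2) by
      field_simp, ← Real.exp_add, Real.one_le_exp_iff, neg_mul, neg_div, mul_div_assoc]
  have := mul_le_mul_of_nonneg_left h3 Real.pi_pos.le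
  linarith

theorem setLIntegral_tube_le (hδ : 0 < δ) (hT : ∀ s ∈ I, ∀ r ∈ I, ‖γ s - γ r‖ ≤ T * |s - r|)
    (hT0 : 0 ≤ T) {r : ℝ} (hs : s ∈ I) (hr : r ∈ I) (hsr : |s - r| ≤ δ) {h : E d × ℝ → ℝ}
    (h0 : ∀ p, 0 ≤ h p) (hi : Integrable h) (x : E d) :
    ∫⁻ p in tube γ δ s, ENNReal.ofReal (h (x - p.1, p.2)) ≤
      ENNReal.ofReal (δ ^ d * Real.exp (Real.pi * (1 + T) ^ 2) * gaussAvgReal δ h x (γ r)) := by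
  rw [ENNReal.ofReal_mul (by positivity), ofReal_gaussAvgReal hδ h0 hi,
    ← lintegral_const_mul' _ _ ENNReal.ofReal_ne_top,
    ← (measurePreserving_reflect x).lintegral_comp_emb (measurableEmbedding_reflect x)]
  refine (setLIntegral_mono' (isClosed_tube γ δ s).measurableSet fun p hp => ?_).trans
    (setLIntegral_le_lintegral _ _)
  simp only [sub_sub_cancel]
  rw [← mul_assoc, ← ENNReal.ofReal_mul (by positivity)]
  refine le_mul_of_one_le_left zero_le (ENNReal.one_le_ofReal.2 ?_)
  exact one_le_gauss_of_mem_tube hδ hT hT0 hs hr hsr hp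

theorem le_average_of_le {f : ℝ → ℝ} (hf : Continuous f) {a ε : ℝ} (hε : 0 < ε)
    (h : ∀ u ∈ Icc 0 ε, a ≤ f u) : a ≤ ε⁻¹ * ∫ u in (0 : ℝ)..ε, f u := by
  have h1 : ∫ _ in (0 : ℝ)..ε, a ≤ ∫ u in (0 : ℝ)..ε, f u :=
    intervalIntegral.integral_mono_on hε.le intervalIntegrable_const (hf.intervalIntegrable _ _) h
  rw [intervalIntegral.integral_const, sub_zero, smul_eq_mul] at h1
  rw [inv_mul_eq_div, le_div_iff₀ hε]
  linarith

/-- Averages over tubes of non-negative functions are dominated by the energy. -/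
theorem sq_tube_average_le_energy (hγ : ContDiffOn ℝ ∞ γ I) (hδ : 0 < δ)
    (hT : ∀ s ∈ I, ∀ r ∈ I, ‖γ s - γ r‖ ≤ T * |s - r|) (hT0 : 0 ≤ T) {α β : ℝ}
    (hα : -1 ≤ α) (hαβ : α < β) (hβ : β ≤ 1) (hδ1 : δ < 1) (hs : s ∈ Icc α β) {h : E d × ℝ → ℝ}
    (h0 : ∀ p, 0 ≤ h p) (hi : Integrable h) (x : E d) :
    ((volume (tube γ δ s))⁻¹ * ∫⁻ p in tube γ δ s, ENNReal.ofReal (h (x - p.1, p.2))) ^ 2 ≤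
      (ENNReal.ofReal (Real.exp (Real.pi * (1 + T) ^ 2)) *
        (2 * volume (Metric.ball (0 : E d) 1))⁻¹) ^ 2 *
      energy α β δ (fun p => (h p : ℂ)) (extendedDeriv γ 0) x := by
  -- With this choice `ε ≤ δ`, so the Gaussian comparison holds throughout the averaging interval,
  -- and the logarithm of `(β - α) / 2 / ε` is exactly `log δ⁻¹`.
  set ε := (β - α) / 2 * δ with hε
  have hba : 0 < β - α := by linarith
  have hε0 : 0 < ε := by positivity
  have hεl : ε ≤ (β - α) / 2 := mul_le_of_le_one_right (by positivity) hδ1.le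
  have hεδ : ε ≤ δ := mul_le_of_le_one_left hδ.le (by linarith)
  have hJ : Icc α β ⊆ I := Icc_subset_Icc hα hβ
  set g : E d × ℝ → ℂ := fun p => (h p : ℂ) with hg
  have hgi : Integrable g := hi.ofReal
  have hc : Continuous fun r => gaussAvg δ g x (extendedDeriv γ 0 r) :=
    (continuous_gaussAvg hδ hgi).comp (f := fun r : ℝ => (x, extendedDeriv γ 0 r))
      (continuous_const.prodMk (continuous_extendedDeriv hγ 0))
  obtain ⟨σ, hσ, hmem, hbound⟩ := exists_enorm_sq_average_le hc hε0 hεl hs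
  set Q := δ ^ d * Real.exp (Real.pi * (1 + T) ^ 2) with hQ
  have hQ0 : 0 < Q := by positivity
  set A := ∫⁻ p in tube γ δ s, ENNReal.ofReal (h (x - p.1, p.2)) with hA
  have hR : ∀ r, gaussAvg δ g x (extendedDeriv γ 0 r) =
      (gaussAvgReal δ h x (extendedDeriv γ 0 r) : ℂ) := fun r => gaussAvg_ofReal δ h x _
  have hcR : Continuous fun r => gaussAvgReal δ h x (extendedDeriv γ 0 r) := by
    have := Complex.continuous_re.comp hc
    simpa [Function.comp_def, hR] using this
  have hle : ∀ u ∈ Icc 0 ε,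
      A ≤ ENNReal.ofReal (Q * gaussAvgReal δ h x (extendedDeriv γ 0 (s + σ * u))) := by
    intro u hu
    have hm := hJ (hmem u hu)
    rw [extendedDeriv_zero_of_mem hm]
    refine setLIntegral_tube_le hδ hT hT0 (hJ hs) hm ?_ h0 hi x
    rw [show s - (s + σ * u) = -(σ * u) by ring, abs_neg, abs_mul, hσ, one_mul, abs_of_nonneg hu.1]
    exact hu.2.trans hεδ
  have hAfin : A ≠ ⊤ := ((hle 0 ⟨le_rfl, hε0.le⟩).trans_lt ENNReal.ofReal_lt_top).ne
  have hnn : ∀ c, 0 ≤ gaussAvgReal δ h x c :=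
    fun c => integral_nonneg fun p => mul_nonneg (gauss_nonneg hδ _) (h0 p)
  have hA' : A ≤ ENNReal.ofReal Q *
      ‖ε⁻¹ • ∫ u in (0 : ℝ)..ε, gaussAvg δ g x (extendedDeriv γ 0 (s + σ * u))‖ₑ := by
    have h1 : A.toReal ≤ ε⁻¹ * ∫ u in (0 : ℝ)..ε,
        Q * gaussAvgReal δ h x (extendedDeriv γ 0 (s + σ * u)) :=
      le_average_of_le (continuous_const.mul (hcR.comp (by fun_prop))) hε0 fun u hu =>
        ENNReal.toReal_le_of_le_ofReal (mul_nonneg hQ0.le (hnn _)) (hle u hu)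
    rw [intervalIntegral.integral_const_mul] at h1
    have h2 : ε⁻¹ • ∫ u in (0 : ℝ)..ε, gaussAvg δ g x (extendedDeriv γ 0 (s + σ * u)) =
        ((ε⁻¹ * ∫ u in (0 : ℝ)..ε,
          gaussAvgReal δ h x (extendedDeriv γ 0 (s + σ * u)) : ℝ) : ℂ) := by
      simp_rw [hR]
      rw [intervalIntegral.integral_ofReal]
      simp
    rw [h2, ← ofReal_norm, Complex.norm_real, Real.norm_of_nonneg (mul_nonneg (by positivity)
      (intervalIntegral.integral_nonneg hε0.le fun u _ => hnn _)), ← ENNReal.ofReal_mul hQ0.le,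
      ← ENNReal.ofReal_toReal hAfin]
    apply ENNReal.ofReal_le_ofReal
    linarith
  have hlog : (β - α) / 2 / ε = δ⁻¹ := by
    rw [hε]
    field_simp
  rw [hlog] at hbound
  have hball : 2 * volume (Metric.ball (0 : E d) 1) ≠ ⊤ :=
    ENNReal.mul_ne_top (by norm_num) Metric.isBounded_ball.measure_lt_top.ne
  -- The powers of `δ` from the tube volume and the Gaussian normalisation cancel, leaving a
  -- constant independent of `δ`.
  have hconst : (volume (tube γ δ s))⁻¹ * ENNReal.ofReal Q =
      ENNReal.ofReal (Real.exp (Real.pi * (1 + T) ^ 2)) *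
        (2 * volume (Metric.ball (0 : E d) 1))⁻¹ := by
    have hδd : ENNReal.ofReal (δ ^ d) ≠ 0 := by
      rw [Ne, ENNReal.ofReal_eq_zero, not_le]
      positivity
    rw [volume_tube hδ, hQ, ENNReal.ofReal_mul (by positivity),
      ENNReal.mul_inv (Or.inl hδd) (Or.inl ENNReal.ofReal_ne_top),
      mul_comm (ENNReal.ofReal (δ ^ d))⁻¹, mul_assoc, ← mul_assoc (ENNReal.ofReal (δ ^ d))⁻¹,
      ENNReal.inv_mul_cancel hδd ENNReal.ofReal_ne_top, one_mul, mul_comm]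
  calc ((volume (tube γ δ s))⁻¹ * A) ^ 2
      ≤ ((volume (tube γ δ s))⁻¹ * (ENNReal.ofReal Q *
        ‖ε⁻¹ • ∫ u in (0 : ℝ)..ε, gaussAvg δ g x (extendedDeriv γ 0 (s + σ * u))‖ₑ)) ^ 2 := by
        gcongr
    _ = ((volume (tube γ δ s))⁻¹ * ENNReal.ofReal Q) ^ 2 *
        ‖ε⁻¹ • ∫ u in (0 : ℝ)..ε, gaussAvg δ g x (extendedDeriv γ 0 (s + σ * u))‖ₑ ^ 2 := by
        rw [← mul_assoc, mul_pow]
    _ ≤ _ := by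
        rw [hconst]
        exact mul_le_mul_right hbound _

end Pointwise

end Nikodym

namespace Nikodym

/-! ### Truncation, summation over the short intervals, and the theorem. -/

section Conclusion

open scoped Topology

variable {d : ℕ} {γ : ℝ → E d} {δ : ℝ} {g : E d × ℝ → ℂ}

/-- The truncation of `|g|` to `closedBall 0 n × [-1, 1]`. -/
noncomputable def truncation (g : E d × ℝ → ℂ) (n : ℕ) : E d × ℝ → ℝ :=
  (Metric.closedBall (0 : E d) n ×ˢ I).indicator fun p => ‖g p‖

theorem isCompact_truncation_set (n : ℕ) : IsCompact (Metric.closedBall (0 : E d) n ×ˢ I) :=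
  (isCompact_closedBall _ _).prod isCompact_Icc

theorem truncation_nonneg (g : E d × ℝ → ℂ) (n : ℕ) (p : E d × ℝ) : 0 ≤ truncation g n p :=
  indicator_nonneg (fun _ _ => norm_nonneg _) _

theorem truncation_le (g : E d × ℝ → ℂ) (n : ℕ) (p : E d × ℝ) : truncation g n p ≤ ‖g p‖ :=
  indicator_apply_le' (fun _ => le_rfl) fun _ => norm_nonneg _

theorem truncation_eq_zero {n : ℕ} {p : E d × ℝ} (hp : p.2 ∉ I) : truncation g n p = 0 :=
  indicator_of_notMem (fun h => hp h.2) _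

theorem monotone_truncation (g : E d × ℝ → ℂ) (p : E d × ℝ) :
    Monotone fun n => truncation g n p := by
  intro m n hmn
  exact indicator_le_indicator_of_subset
    (prod_mono_left (Metric.closedBall_subset_closedBall (by exact_mod_cast hmn)))
    (fun _ => norm_nonneg _) p

theorem iSup_truncation {p : E d × ℝ} (hp : p.2 ∈ I) :
    ⨆ n, ENNReal.ofReal (truncation g n p) = ‖g p‖ₑ := by
  refine le_antisymm (iSup_le fun n => ?_) ?_
  · rw [← ofReal_norm]
    exact ENNReal.ofReal_le_ofReal (truncation_le g n p)
  · obtain ⟨n, hn⟩ := exists_nat_ge ‖p.1‖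
    refine le_iSup_of_le n (le_of_eq ?_)
    rw [truncation, indicator_of_mem (show p ∈ Metric.closedBall (0 : E d) n ×ˢ I from
      ⟨by simpa using hn, hp⟩), ofReal_norm]

theorem stronglyMeasurable_truncation (hg : StronglyMeasurable g) (n : ℕ) :
    StronglyMeasurable (truncation g n) :=
  hg.norm.indicator (isCompact_truncation_set n).measurableSet

theorem integrable_truncation (hg : MemLp g 2) (n : ℕ) : Integrable (truncation g n) :=
  (integrable_indicator_iff (isCompact_truncation_set n).measurableSet).2
    ((hg.locallyIntegrable (by norm_num)).integrableOn_isCompact (isCompact_truncation_set n)).norm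

theorem lintegral_truncation_sq_le (g : E d × ℝ → ℂ) (n : ℕ) :
    ∫⁻ p, ‖(truncation g n p : ℂ)‖ₑ ^ 2 ≤ ∫⁻ p, ‖g p‖ₑ ^ 2 := by
  refine lintegral_mono fun p => ?_
  simp only
  gcongr
  rw [enorm_le_iff_norm_le, Complex.norm_real, Real.norm_of_nonneg (truncation_nonneg g n p)]
  exact truncation_le g n p

theorem exists_subinterval {N : ℕ} (hN : 0 < N) {s : ℝ} (hs : s ∈ I) :
    ∃ i ∈ Finset.range N, s ∈ Icc (-1 + 2 / N * (i : ℝ)) (-1 + 2 / N * (i + 1 : ℝ)) := by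
  have hN0 : (0 : ℝ) < N := by exact_mod_cast hN
  have e : ∀ t : ℝ, 2 / N * t = 2 * t / N := fun t => by ring
  rcases hs.2.lt_or_eq with h | h
  · have h0 : 0 ≤ (s + 1) * N / 2 := by
      have := hs.1
      have : 0 ≤ s + 1 := by linarith
      positivity
    refine ⟨⌊(s + 1) * N / 2⌋₊, ?_, ?_, ?_⟩
    · rw [Finset.mem_range, Nat.floor_lt h0]
      nlinarith
    · have := Nat.floor_le h0
      rw [← le_sub_iff_add_le', e, div_le_iff₀ hN0]
      linarith
    · have := (Nat.lt_floor_add_one ((s + 1) * N / 2)).le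
      rw [← sub_le_iff_le_add', e, le_div_iff₀ hN0]
      linarith
  -- At the right endpoint `s = 1` the floor would give the index `N`, which is out of range.
  · refine ⟨N - 1, by simp [hN], ?_⟩
    have h1 : ((N - 1 : ℕ) : ℝ) = N - 1 := by
      rw [Nat.cast_sub hN, Nat.cast_one]
    rw [h1, h]
    constructor
    · rw [← le_sub_iff_add_le', e, div_le_iff₀ hN0]
      linarith
    · rw [← sub_le_iff_le_add', e, le_div_iff₀ hN0]
      linarith

theorem tube_average_eq_iSup (hg : StronglyMeasurable g) (δ s : ℝ) (x : E d) :
    (volume (tube γ δ s))⁻¹ * ∫⁻ p in tube γ δ s, ‖g (x - p.1, p.2)‖ₑ =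
      ⨆ n, (volume (tube γ δ s))⁻¹ *
        ∫⁻ p in tube γ δ s, ENNReal.ofReal (truncation g n (x - p.1, p.2)) := by
  rw [← ENNReal.mul_iSup, ← lintegral_iSup]
  · congr 1
    refine setLIntegral_congr_fun (isClosed_tube γ δ s).measurableSet fun p hp => ?_
    exact (iSup_truncation (show (x - p.1, p.2).2 ∈ I from hp.1)).symm
  · intro n
    exact ENNReal.measurable_ofReal.comp ((stronglyMeasurable_truncation hg n).measurable.comp
      (by fun_prop))
  · intro m n hmn p
    exact ENNReal.ofReal_le_ofReal (monotone_truncation g _ hmn)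

theorem sq_maximal_le_of_stronglyMeasurable (hγ : IsNondegenerate γ) :
    ∃ M : ℝ, 0 ≤ M ∧ ∀ δ : ℝ, 0 < δ → δ < 1 → ∀ g : E d × ℝ → ℂ, StronglyMeasurable g →
      MemLp g 2 → ∫⁻ x, maximal γ δ g x ^ 2 ≤
        ENNReal.ofReal (M * max 1 (Real.log δ⁻¹) ^ d) * ∫⁻ p, ‖g p‖ₑ ^ 2 := by
  obtain ⟨T, hT1, hT⟩ := exists_norm_deriv_le hγ.1
  obtain ⟨c, hc, N, hN, hnd⟩ := exists_uniform_nondegenerate hγ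
  have hT0 : 0 ≤ T := (norm_nonneg _).trans (hT1 0 ⟨by norm_num, by norm_num⟩)
  have hN0 : (0 : ℝ) < N := by exact_mod_cast hN
  set K : ℝ := 160 + 8 * (160 * (Real.pi * (T + 4 / c)) + 3120 * d) with hK
  have hK0 : 0 ≤ K := by
    have := Real.pi_pos
    positivity
  set C₀ : ℝ≥0∞ := ENNReal.ofReal (Real.exp (Real.pi * (1 + T) ^ 2)) *
        (2 * volume (Metric.ball (0 : E d) 1))⁻¹ with hC₀
  have hC₀top : C₀ ≠ ⊤ := by
    refine ENNReal.mul_ne_top ENNReal.ofReal_ne_top (ENNReal.inv_ne_top.2 ?_)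
    exact mul_ne_zero (by norm_num) (Metric.measure_ball_pos volume (0 : E d) one_pos).ne'
  refine ⟨C₀.toReal ^ 2 * (N * K), by positivity, fun δ hδ hδ1 g hgm hg => ?_⟩
  set L := max 1 (Real.log δ⁻¹) with hL
  have hL1 : 1 ≤ L := le_max_left _ _
  set a : ℕ → ℝ := fun i => -1 + 2 / N * (i : ℝ) with ha
  set b : ℕ → ℝ := fun i => -1 + 2 / N * (i + 1 : ℝ) with hb
  have hba : ∀ i, b i - a i = 2 / N := fun i => by simp only [ha, hb]; ring
  have hab : ∀ i, a i < b i := fun i => by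
    have := hba i
    have : 0 < 2 / (N : ℝ) := by positivity
    linarith
  have ha1 : ∀ i, -1 ≤ a i := fun i => by
    have : 0 ≤ 2 / (N : ℝ) * i := by positivity
    simp only [ha]
    linarith
  have hb1 : ∀ i ∈ Finset.range N, b i ≤ 1 := fun i hi => by
    have h1 : (i : ℝ) + 1 ≤ N := by exact_mod_cast Finset.mem_range.1 hi
    have h2 : 2 / (N : ℝ) * (i + 1) ≤ 2 / N * N := by gcongr
    rw [div_mul_cancel₀ _ hN0.ne'] at h2
    simp only [hb]
    linarith
  set Γ := extendedDeriv γ with hΓ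
  have hΓc := continuous_extendedDeriv hγ.1
  have hgi : ∀ n, Integrable fun p => (truncation g n p : ℂ) :=
    fun n => (integrable_truncation hg n).ofReal
  have hgtop : ∫⁻ p, ‖g p‖ₑ ^ 2 ≠ ⊤ := by
    rw [lintegral_enorm_sq_eq_eLpNorm]
    exact ENNReal.pow_ne_top hg.2.ne
  -- Summing over all `N` intervals gives one majorant valid for every `s`. Truncation makes the
  -- functions integrable and supported in `t ∈ [-1, 1]`, as the Fourier argument requires.
  set H : ℕ → E d → ℝ≥0∞ := fun n x => C₀ ^ 2 * ∑ i ∈ Finset.range N,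
    energy (a i) (b i) δ (fun p => (truncation g n p : ℂ)) (Γ 0) x with hH
  have hHm : ∀ n, Measurable (H n) := fun n =>
    (Finset.measurable_fun_sum _ fun i _ => measurable_energy hδ (hgi n) (hΓc 0) _ _).const_mul _
  have hHint : ∀ n, ∫⁻ x, H n x ≤
      ENNReal.ofReal (C₀.toReal ^ 2 * (N * K) * L ^ d) * ∫⁻ p, ‖g p‖ₑ ^ 2 := by
    intro n
    have hE : ∀ i ∈ Finset.range N,
        ∫⁻ x, energy (a i) (b i) δ (fun p => (truncation g n p : ℂ)) (Γ 0) x ≤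
          ENNReal.ofReal (K * L ^ d) * ∫⁻ p, ‖g p‖ₑ ^ 2 := by
      intro i hi
      have hsub : Icc (a i) (b i) ⊆ I := Icc_subset_Icc (ha1 i) (hb1 i hi)
      refine (lintegral_energy_le (hab i) hΓc (fun j s hs => hasDerivAt_extendedDeriv hγ.1 j
        ⟨(ha1 i).trans_lt hs.1, hs.2.trans_le (hb1 i hi)⟩) (fun s hs => hT1 s (hsub hs)) hc
        (hnd (a i) (b i) (ha1 i) (hab i).le (hb1 i hi) (hba i).le) hδ hδ1
        (Complex.continuous_ofReal.comp_stronglyMeasurable (stronglyMeasurable_truncation hgm n))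
        (hgi n) ((lintegral_truncation_sq_le g n).trans_lt hgtop.lt_top).ne
        (fun p hp => by rw [truncation_eq_zero hp, Complex.ofReal_zero])).trans ?_
      exact mul_le_mul_right (lintegral_truncation_sq_le g n) _
    rw [lintegral_const_mul _ (Finset.measurable_fun_sum _ fun i _ =>
      measurable_energy hδ (hgi n) (hΓc 0) _ _), lintegral_finsetSum _ fun i _ =>
      measurable_energy hδ (hgi n) (hΓc 0) _ _]
    refine (mul_le_mul_right (Finset.sum_le_sum hE) _).trans (le_of_eq ?_)
    rw [Finset.sum_const, Finset.card_range, nsmul_eq_mul, mul_assoc (C₀.toReal ^ 2),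
      ENNReal.ofReal_mul (p := C₀.toReal ^ 2) (by positivity),
      ENNReal.ofReal_pow ENNReal.toReal_nonneg, ENNReal.ofReal_toReal hC₀top, mul_assoc (N : ℝ),
      ENNReal.ofReal_mul (p := (N : ℝ)) (by positivity), ENNReal.ofReal_natCast]
    ring
  -- The tube averages increase with the truncation, but the energies involve differences and need
  -- not; so the bound passes to a lower limit and Fatou's lemma finishes.
  have hpt : ∀ x, maximal γ δ g x ^ 2 ≤ Filter.liminf (fun n => H n x) Filter.atTop := by
    intro x
    set W := Filter.liminf (fun n => H n x) Filter.atTop with hW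
    have hroot : maximal γ δ g x ≤ W ^ (1 / 2 : ℝ) := by
      refine iSup₂_le fun s hs => (enorm_avg_le γ δ g x s).trans ?_
      rw [tube_average_eq_iSup hgm]
      refine iSup_le fun n => ?_
      rw [one_div, ENNReal.le_rpow_inv_iff two_pos, ENNReal.rpow_two]
      refine Filter.le_liminf_of_le (by isBoundedDefault) ?_
      filter_upwards [Filter.eventually_ge_atTop n] with m hm
      obtain ⟨i, hi, hsi⟩ := exists_subinterval hN hs
      calc _ ≤ ((volume (tube γ δ s))⁻¹ *
            ∫⁻ p in tube γ δ s, ENNReal.ofReal (truncation g m (x - p.1, p.2))) ^ 2 := by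
              gcongr with p
              exact monotone_truncation g _ hm
        _ ≤ C₀ ^ 2 * energy (a i) (b i) δ (fun p => (truncation g m p : ℂ)) (Γ 0) x :=
            sq_tube_average_le_energy hγ.1 hδ hT hT0 (ha1 i) (hab i) (hb1 i hi) hδ1 hsi
              (truncation_nonneg g m) (integrable_truncation hg m) x
        _ ≤ H m x := mul_le_mul_right (Finset.single_le_sum (f := fun i =>
            energy (a i) (b i) δ (fun p => (truncation g m p : ℂ)) (Γ 0) x)
            (fun _ _ => zero_le) hi) _
    calc maximal γ δ g x ^ 2 ≤ (W ^ (1 / 2 : ℝ)) ^ 2 := by gcongr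
      _ = W := by
        rw [← ENNReal.rpow_natCast, ← ENNReal.rpow_mul]
        norm_num
  calc ∫⁻ x, maximal γ δ g x ^ 2
      ≤ ∫⁻ x, Filter.liminf (fun n => H n x) Filter.atTop := lintegral_mono hpt
    _ ≤ Filter.liminf (fun n => ∫⁻ x, H n x) Filter.atTop := lintegral_liminf_le hHm
    _ ≤ Filter.liminf (fun _ : ℕ => ENNReal.ofReal (C₀.toReal ^ 2 * (N * K) * L ^ d) *
          ∫⁻ p, ‖g p‖ₑ ^ 2) Filter.atTop :=
        Filter.liminf_le_liminf (Filter.Eventually.of_forall hHint)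
    _ = _ := Filter.liminf_const _

end Conclusion

end Nikodym

theorem theorem1 (d : ℕ) (γ : ℝ → Nikodym.E d) (hγ : Nikodym.IsNondegenerate γ) :
    ∃ C : ℝ, 0 < C ∧ ∀ δ : ℝ, 0 < δ → δ < 1 →
      ∀ g : Nikodym.E d × ℝ → ℂ, MemLp g 2 volume →
        MemLp (Nikodym.maximal γ δ g) 2 volume ∧
        eLpNorm (Nikodym.maximal γ δ g) 2 volume ≤
          ENNReal.ofReal (C * (max 1 (Real.log δ⁻¹)) ^ ((d : ℝ) / 2)) *
            eLpNorm g 2 volume := by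
  obtain ⟨M, hM, h⟩ := Nikodym.sq_maximal_le_of_stronglyMeasurable hγ
  -- Adding `1` ensures a positive constant even if `M = 0`.
  refine ⟨√M + 1, by positivity, fun δ hδ hδ1 g hg => ?_⟩
  set L := max 1 (Real.log δ⁻¹) with hL
  have hL0 : 0 < L := one_pos.trans_le (le_max_left _ _)
  have hbound : eLpNorm (Nikodym.maximal γ δ g) 2 volume ≤
      ENNReal.ofReal ((√M + 1) * L ^ ((d : ℝ) / 2)) * eLpNorm g 2 volume := by
    have hae := hg.1.ae_eq_mk
    have hmax : Nikodym.maximal γ δ g = Nikodym.maximal γ δ (hg.1.mk g) := by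
      unfold Nikodym.maximal
      rw [Nikodym.avg_congr_ae hae]
    have hsq := h δ hδ hδ1 (hg.1.mk g) hg.1.stronglyMeasurable_mk (hg.ae_eq hae)
    rw [← hmax, Nikodym.lintegral_enorm_sq_eq_eLpNorm, ← eLpNorm_congr_ae hae] at hsq
    have hroot : ENNReal.ofReal (M * L ^ d) = ENNReal.ofReal (√M * L ^ ((d : ℝ) / 2)) ^ 2 := by
      rw [← ENNReal.ofReal_pow (by positivity), mul_pow, Real.sq_sqrt hM, ← Real.rpow_natCast _ 2,
        ← Real.rpow_mul hL0.le, Nat.cast_ofNat, div_mul_cancel₀ _ two_ne_zero, Real.rpow_natCast]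
    rw [eLpNorm_eq_lintegral_rpow_enorm_toReal two_ne_zero ENNReal.ofNat_ne_top]
    simp only [ENNReal.toReal_ofNat, enorm_eq_self, ENNReal.rpow_two]
    rw [one_div, ENNReal.rpow_inv_le_iff two_pos, ENNReal.rpow_two]
    refine hsq.trans ?_
    rw [hroot, ← mul_pow]
    gcongr
    linarith
  exact ⟨⟨(Nikodym.measurable_maximal hδ hg γ).aestronglyMeasurable,
    hbound.trans_lt (ENNReal.mul_lt_top ENNReal.ofReal_lt_top hg.2)⟩, hbound⟩
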